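/- Let $\mathcal H$ be a reproducing kernel Hilbert space of real functions on a metric space $\mathcal X$, with measurable kernel $K$, and suppose (A1) $\sup_{x,y\in\mathcal X}K(x,y)<\infty$. Let $s\ge 2$ and let $\mathbb P_1,\dots,\mathbb P_s$ be Borel probability measures on $\mathcal X$. For each $j$ let $X^{(j)}_1,X^{(j)}_2,\dots$ be i.i.d. with law $\mathbb P_j$, the $s$ samples being mutually independent. For sample sizes $n_1,\dots,n_s$ put $n=\sum_j n_j$, $\pi_j=n_j/n$ and $\widehat m_j=n_j^{-1}\sum_{i=1}^{n_j}K(X_i^{(j)},\cdot)$. Suppose (A2) there are $\rho_1,\dots,\rho_s\in(0,1)$ with $\sqrt n\,(\pi_j-\rho_j)\to0$ for every $j$, as $\min_j n_j\to\infty$. For $\gamma\in(0,1]$ let $(k_{i,r}(\gamma))_{1\le i\le r}$, $r\ge 1$, be nonnegative real weights such that (A3) for each $\gamma$ there are $\tau>0$ and $n_0\in\mathbb N$ with $r\,\bigl|\frac1r\sum_{i=1}^r k_{i,r}(\gamma)-1\bigr|\le\tau$ for all $r>n_0$; (A4) there is $c_k$ with $\max_{1\le i\le r}k_{i,r}(\gamma)<c_k$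 for all $r\ge1$ and $\gamma\in(0,1]$; (A5) for every $\gamma\in(0,1]$, $\frac1r\sum_{i=1}^r k_{i,r}^2(\gamma)\to k^2(\gamma)$ as $r\to\infty$, where $k^2(\gamma)>1$. Then the kernel mean embeddings $m_j=\mathbb E\,K(X^{(j)}_1,\cdot)\in\mathcal H$ exist (as weak expectations: $\langle m_j,f\rangle_{\mathcal H}=\mathbb E f(X_1^{(j)})$ for all $f\in\mathcal H$). Put $\mathscr T=\sum_{j}\sum_{\ell\ne j}\rho_\ell\|m_j-m_\ell\|_{\mathcal H}^2$, $m=\sum_j\rho_jm_j$, $\mu=\sum_jm_j$, $$\widehat{\mathscr T}_{n,\gamma}=\sum_{j}\sum_{\ell\ne j}\pi_\ell\Bigl\{\|\widehat m_j\|_{\mathcal H}^2+\|\widehat m_\ell\|_{\mathcal H}^2-\frac2{n_j}\sum_{i=1}^{n_j}k_{i,n_j}(\gamma)\langle K(X_i^{(j)},\cdot),\widehat m_\ell\rangle_{\mathcal H}\Bigr\},$$ $\mathcal U_j(x)=\langle K(x,\cdot)-m_j,(1-2\rho_j+s\rho_j)m_j+\rho_j(m_j-\mu)\rangle_{\mathcal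 H}$ and $\mathcal V_j(x)=\langle K(x,\cdot)-m_j,m-\rho_jm_j\rangle_{\mathcal H}$. For every $\gamma\in(0,1]$, as $\min_jn_j\to\infty$, $$\sqrt n\,\bigl(\widehat{\mathscr T}_{n,\gamma}-\mathscr T\bigr)\xrightarrow{\ \mathscr D\ }\mathcal N(0,\sigma_\gamma^2),\qquad \sigma_\gamma^2=\sum_{j=1}^s4\rho_j^{-1}\sigma_j^2(\gamma)\ge0,$$ where $$\sigma_j^2(\gamma)=\operatorname{Var}\mathcal U_j(X_1^{(j)})+k^2(\gamma)\operatorname{Var}\mathcal V_j(X_1^{(j)})-2\operatorname{Cov}\bigl(\mathcal U_j(X_1^{(j)}),\mathcal V_j(X_1^{(j)})\bigr)$$ (and $\mathcal N(0,0)$ is the Dirac mass at $0$). Moreover, if $\mathbb P_1=\dots=\mathbb P_s$, then $\sigma_\gamma^2=4\,(k^2(\gamma)-1)\,\nu^2\sum_{j=1}^s\rho_j^{-1}(1-\rho_j)^2$ with $\nu^2=\operatorname{Var}\langle K(X_1^{(1)},\cdot)-m,m\rangle_{\mathcal H}$, so that in this case the limit is non-degenerate ($\sigma_\gamma^2>0$)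 if and only if $\nu^2>0$. -/

import Mathlib

open MeasureTheory ProbabilityTheory Filter Topology

namespace GMMD

noncomputable section

section Kernel

variable {𝒳 : Type*} (H : Type*) [NormedAddCommGroup H] [InnerProductSpace ℝ H]
  [CompleteSpace H] [RKHS ℝ H 𝒳 ℝ]

/-- The function `K(x, ·)`, as an element of the reproducing kernel Hilbert space `H`. -/
def feature (x : 𝒳) : H := RKHS.kerFun H x (1 : ℝ)

/-- The real-valued reproducing kernel `K(x, y)` of `H`. -/
def ker (x y : 𝒳) : ℝ := RKHS.kernel H x y (1 : ℝ)

variable [MeasurableSpace 𝒳]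

/-- `h` is the kernel mean embedding `𝔼 K(X, ·)` of the law `P` of `X`: the (weak) expectation in
`H`, that is the element with `⟪h, f⟫ = 𝔼 f(X)` for all `f ∈ H`. There is at most one. -/
def IsMeanEmbedding (P : Measure 𝒳) (h : H) : Prop :=
  ∀ f : H, Integrable (fun x => f x) P ∧ inner ℝ h f = ∫ x, f x ∂P

open Classical in
/-- The kernel mean embedding of `P` (and `0` if there is none). -/
def meanEmbedding (P : Measure 𝒳) : H :=
  if h : ∃ m : H, IsMeanEmbedding H P m then h.choose else 0

/-- The maximum mean discrepancy. -/
def MMD (P Q : Measure 𝒳) : ℝ := ‖meanEmbedding H P - meanEmbedding H Q‖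

variable {s : ℕ}

/-- The squared generalized maximum mean discrepancy of `P₁, …, Pₛ` with weights `η`. -/
def gmmdSq (P : Fin s → Measure 𝒳) (η : Fin s → ℝ) : ℝ :=
  ∑ j, ∑ l ∈ Finset.univ.erase j, η l * MMD H (P j) (P l) ^ 2

/-- `m = ∑ ρⱼ mⱼ`. -/
def mixMean (P : Fin s → Measure 𝒳) (ρ : Fin s → ℝ) : H :=
  ∑ j, ρ j • meanEmbedding H (P j)

/-- `μ = ∑ mⱼ`. -/
def sumMean (P : Fin s → Measure 𝒳) : H := ∑ j, meanEmbedding H (P j)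

/-- The function `𝒰ⱼ`. -/
def U (P : Fin s → Measure 𝒳) (ρ : Fin s → ℝ) (j : Fin s) (x : 𝒳) : ℝ :=
  inner ℝ (feature H x - meanEmbedding H (P j))
    ((1 - 2 * ρ j + s * ρ j) • meanEmbedding H (P j)
      + ρ j • (meanEmbedding H (P j) - sumMean H P))

/-- The function `𝒱ⱼ`. -/
def V (P : Fin s → Measure 𝒳) (ρ : Fin s → ℝ) (j : Fin s) (x : 𝒳) : ℝ :=
  inner ℝ (feature H x - meanEmbedding H (P j))
    (mixMean H P ρ - ρ j • meanEmbedding H (P j))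

/-- `σⱼ²(γ)`, where `kSq` is the value of `k²(γ)`. -/
def sigmaSqPart (P : Fin s → Measure 𝒳) (ρ : Fin s → ℝ) (kSq : ℝ) (j : Fin s) : ℝ :=
  Var[U H P ρ j; P j] + kSq * Var[V H P ρ j; P j] - 2 * cov[U H P ρ j, V H P ρ j; P j]

/-- `σ²_γ`, where `kSq` is the value of `k²(γ)`. -/
def sigmaSq (P : Fin s → Measure 𝒳) (ρ : Fin s → ℝ) (kSq : ℝ) : ℝ :=
  ∑ j, 4 * (ρ j)⁻¹ * sigmaSqPart H P ρ kSq j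

/-- `ν² = Var ⟪K(X, ·) - h, h⟫` for `X` with law `P`, where `h` is the mean embedding of `P`. -/
def nuSq (P : Measure 𝒳) : ℝ :=
  Var[fun x => inner ℝ (feature H x - meanEmbedding H P) (meanEmbedding H P); P]

end Kernel

/-- The total sample size `n = ∑ nⱼ`. -/
def total {s : ℕ} (n : Fin s → ℕ) : ℕ := ∑ j, n j

/-- The sample fraction `πⱼ = nⱼ / n`. -/
def fraction {s : ℕ} (n : Fin s → ℕ) (j : Fin s) : ℝ := (n j : ℝ) / (total n : ℝ)

section Estimator

variable {𝒳 : Type*} (H : Type*) [NormedAddCommGroup H] [InnerProductSpace ℝ H]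
  [CompleteSpace H] [RKHS ℝ H 𝒳 ℝ]

/-- The empirical mean embedding `r⁻¹ ∑_{i=1}^r K(xᵢ, ·)`. -/
def empMean (r : ℕ) (x : ℕ → 𝒳) : H := (r : ℝ)⁻¹ • ∑ i ∈ Finset.Icc 1 r, feature H (x i)

/-- The modified estimator, for sample sizes `n`, weights `k r i` (for `1 ≤ i ≤ r`), and
samples `x j 1, …, x j (n j)`. -/
def estimator {s : ℕ} (n : Fin s → ℕ) (k : ℕ → ℕ → ℝ) (x : Fin s → ℕ → 𝒳) : ℝ :=
  ∑ j, ∑ l ∈ Finset.univ.erase j, fraction n l *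
    (‖empMean H (n j) (x j)‖ ^ 2 + ‖empMean H (n l) (x l)‖ ^ 2
      - 2 / (n j : ℝ) * ∑ i ∈ Finset.Icc 1 (n j),
          k (n j) i * inner ℝ (feature H (x j i)) (empMean H (n l) (x l)))

end Estimator

end

end GMMD

/-!
The estimator is linearized around the mean embeddings `mⱼ`. With the fluctuations
`Dⱼ = m̂ⱼ - mⱼ` and `Eⱼ = nⱼ⁻¹ ∑ᵢ kᵢ (K(Xᵢ, ·) - mⱼ)`, each summand of the estimator is a constant,
plus a part linear in the fluctuations (`GMMD.linearPart`), plus quadratic terms such as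
`‖Dⱼ‖²` and `⟪Eⱼ, Dₗ⟫`. Collecting the linear parts by samples (`GMMD.sum_linearPart`, which uses
`∑ ρⱼ = 1`) gives the sum over all observations of
`2 (√n / nⱼ) (𝒰ⱼ(Xᵢ) - kᵢ 𝒱ⱼ(Xᵢ))`, which is `GMMD.linearTerm`.

The error of the linearization is negligible (`GMMD.abs_estimator_sub_sum_linearTerm_le`,
`GMMD.remainderBound_integrable_tendsto`). The features are bounded, so replacing the sample
fractions by their limits, and the mean weights by `1`, costs deterministic quantities of order
`√n |πⱼ - ρⱼ|` and `√n / nⱼ`. The quadratic terms have mean of order `√n / nⱼ`, because centred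
features of independent observations are orthogonal in the mean
(`GMMD.integral_inner_centredFeature_of_indepFun`). The Hilbert space need not be separable and the
feature map need not be strongly measurable, so measurability and Fubini's theorem are only ever
applied to the kernel and to the functions in `H`; the mean embeddings come from the Riesz
representation theorem (`GMMD.isMeanEmbedding_meanEmbedding`).

The linear terms form a row-wise independent triangular array with entries of order `√n / nⱼ`,
uniformly, and total variance tending to `σ²`. A central limit theorem for such arrays
(`tendstoInDistribution_sum_of_bounded`) follows by comparing each characteristic function with the
Gaussian one of the same variance and applying Lévy's continuity theorem. Slutsky's theorem
combines the two parts. When all distributions agree, `𝒰ⱼ = 𝒱ⱼ = (1 - ρⱼ) ⟪K(·, ·) - m, m⟫`, which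
gives the formula for the limit variance (`GMMD.sigmaSq_const`).
-/

/-! ### A central limit theorem for bounded triangular arrays -/

/-- Telescoping bound for the difference of two products of numbers in the unit disc. -/
lemma norm_prod_sub_prod_le_sum {ι : Type*} (S : Finset ι) (f g : ι → ℂ)
    (hf : ∀ i ∈ S, ‖f i‖ ≤ 1) (hg : ∀ i ∈ S, ‖g i‖ ≤ 1) :
    ‖∏ i ∈ S, f i - ∏ i ∈ S, g i‖ ≤ ∑ i ∈ S, ‖f i - g i‖ := by
  classical
  induction S using Finset.induction_on with
  | empty => simp
  | insert a S ha ih =>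
    rw [Finset.prod_insert ha, Finset.prod_insert ha, Finset.sum_insert ha]
    have hP : ‖∏ i ∈ S, f i‖ ≤ 1 := by
      rw [norm_prod]
      exact Finset.prod_le_one (fun _ _ => norm_nonneg _)
        fun i hi => hf i (Finset.mem_insert_of_mem hi)
    have h1 := ih (fun i hi => hf i (Finset.mem_insert_of_mem hi))
      (fun i hi => hg i (Finset.mem_insert_of_mem hi))
    have h2 : f a * ∏ i ∈ S, f i - g a * ∏ i ∈ S, g i
        = (f a - g a) * ∏ i ∈ S, f i + g a * (∏ i ∈ S, f i - ∏ i ∈ S, g i) := by ring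
    rw [h2]
    refine (norm_add_le _ _).trans ?_
    rw [norm_mul, norm_mul]
    have h3 := hg a (Finset.mem_insert_self a S)
    gcongr
    · exact mul_le_of_le_one_right (norm_nonneg _) hP
    · exact (mul_le_of_le_one_left (norm_nonneg _) h3).trans h1

/-- Second order Taylor bound for `exp (i x)`. -/
lemma norm_exp_mul_I_sub_taylor_le {x : ℝ} (hx : |x| ≤ 1) :
    ‖Complex.exp (x * Complex.I) - (1 + x * Complex.I - x ^ 2 / 2)‖ ≤ |x| ^ 3 := by
  have hn : ‖(x * Complex.I : ℂ)‖ = |x| := by simp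
  have h := Complex.exp_bound (x := x * Complex.I) (by rw [hn]; exact hx) (n := 3) (by norm_num)
  rw [hn] at h
  have h2 : ∑ m ∈ Finset.range 3, (x * Complex.I : ℂ) ^ m / (m.factorial : ℂ)
      = 1 + x * Complex.I - x ^ 2 / 2 := by
    simp [Finset.sum_range_succ, mul_pow]
    ring
  rw [h2] at h
  refine h.trans (mul_le_of_le_one_right (by positivity) ?_)
  norm_num [Nat.factorial]

/-- The characteristic function of a centered variable bounded by `b` is close to that of the
centered Gaussian variable with the same variance. -/
lemma norm_charFun_sub_exp_le {Ω : Type*} [MeasurableSpace Ω] {μ : Measure Ω}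
    [IsProbabilityMeasure μ] {Z : Ω → ℝ} (hZ : AEMeasurable Z μ) {b t : ℝ} (hb : 0 ≤ b)
    (hZb : ∀ᵐ ω ∂μ, |Z ω| ≤ b) (h0 : ∫ ω, Z ω ∂μ = 0) (htb : |t| * b ≤ 1) :
    ‖charFun (μ.map Z) t - Complex.exp (-(t ^ 2 * ∫ ω, Z ω ^ 2 ∂μ) / 2 : ℝ)‖
      ≤ (|t| ^ 3 * b + t ^ 4 * b ^ 2) * ∫ ω, Z ω ^ 2 ∂μ := by
  set v := ∫ ω, Z ω ^ 2 ∂μ with hv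
  have hv0 : 0 ≤ v := integral_nonneg fun ω => sq_nonneg _
  have hi1 : Integrable Z μ := Integrable.of_bound hZ.aestronglyMeasurable b hZb
  have hsq : ∀ᵐ ω ∂μ, Z ω ^ 2 ≤ b ^ 2 := by
    filter_upwards [hZb] with ω hω
    exact sq_le_sq' (by linarith [abs_le.1 hω]) (abs_le.1 hω).2
  have hi2 : Integrable (fun ω => Z ω ^ 2) μ := by
    refine Integrable.of_bound (hZ.pow_const 2).aestronglyMeasurable (b ^ 2) ?_
    filter_upwards [hsq] with ω hω
    rwa [Real.norm_of_nonneg (sq_nonneg _)]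
  have hvb : v ≤ b ^ 2 := by
    have := integral_mono_ae hi2 (integrable_const (b ^ 2)) hsq
    simpa using this
  have hchar : charFun (μ.map Z) t = ∫ ω, Complex.exp ((t * Z ω : ℝ) * Complex.I) ∂μ := by
    rw [charFun_apply_real, integral_map hZ (by fun_prop)]
    simp
  have hie : Integrable (fun ω => Complex.exp ((t * Z ω : ℝ) * Complex.I)) μ := by
    refine Integrable.of_bound (C := 1) ?_ ?_
    · have : AEMeasurable (fun ω => Complex.exp ((t * Z ω : ℝ) * Complex.I)) μ := by fun_prop
      exact this.aestronglyMeasurable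
    · filter_upwards with ω
      rw [Complex.norm_exp_ofReal_mul_I]
  have hit : Integrable (fun ω => (1 + ((t * Z ω : ℝ) : ℂ) * Complex.I
      - ((t * Z ω : ℝ) : ℂ) ^ 2 / 2)) μ := by
    refine ((integrable_const _).add ?_).sub ?_
    · exact ((hi1.const_mul t).ofReal).mul_const _
    · have : (fun ω => ((t * Z ω : ℝ) : ℂ) ^ 2 / 2)
          = fun ω => ((t ^ 2 / 2 * Z ω ^ 2 : ℝ) : ℂ) := by
        ext ω; push_cast; ring
      rw [this]
      exact (hi2.const_mul _).ofReal
  have htay : ∫ ω, (1 + ((t * Z ω : ℝ) : ℂ) * Complex.I - ((t * Z ω : ℝ) : ℂ) ^ 2 / 2) ∂μ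
      = ((1 - t ^ 2 * v / 2 : ℝ) : ℂ) := by
    have : ∀ ω, (1 + ((t * Z ω : ℝ) : ℂ) * Complex.I - ((t * Z ω : ℝ) : ℂ) ^ 2 / 2)
        = ((1 - t ^ 2 / 2 * Z ω ^ 2 : ℝ) : ℂ) + ((t * Z ω : ℝ) : ℂ) * Complex.I := by
      intro ω; push_cast; ring
    simp_rw [this]
    rw [integral_add, integral_mul_const, integral_complex_ofReal, integral_complex_ofReal,
      integral_const_mul, h0, integral_sub (integrable_const _) (hi2.const_mul _),
      integral_const_mul]
    · simp [← hv]; ring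
    · exact ((integrable_const _).sub (hi2.const_mul _)).ofReal
    · exact ((hi1.const_mul t).ofReal).mul_const _
  have hA : ‖charFun (μ.map Z) t - ((1 - t ^ 2 * v / 2 : ℝ) : ℂ)‖ ≤ |t| ^ 3 * b * v := by
    rw [hchar, ← htay, ← integral_sub hie hit]
    refine (norm_integral_le_integral_norm _).trans ?_
    rw [hv, ← integral_const_mul]
    refine integral_mono_ae (hie.sub hit).norm (hi2.const_mul _) ?_
    filter_upwards [hZb] with ω hω
    have hx : |t * Z ω| ≤ 1 := by
      rw [abs_mul]
      exact (mul_le_mul_of_nonneg_left hω (abs_nonneg t)).trans htb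
    refine (norm_exp_mul_I_sub_taylor_le hx).trans ?_
    rw [abs_mul, mul_pow]
    have : |Z ω| ^ 3 = |Z ω| * Z ω ^ 2 := by rw [← sq_abs]; ring
    rw [this, mul_assoc]
    gcongr
  have htb2 : t ^ 2 * b ^ 2 ≤ 1 := by
    rw [← sq_abs t, ← mul_pow]
    exact pow_le_one₀ (by positivity) htb
  have hB : ‖((1 - t ^ 2 * v / 2 : ℝ) : ℂ) - Complex.exp (-(t ^ 2 * v) / 2 : ℝ)‖
      ≤ t ^ 4 * b ^ 2 * v := by
    have hle : t ^ 2 * v ≤ 1 := (mul_le_mul_of_nonneg_left hvb (sq_nonneg t)).trans htb2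
    have hnn : 0 ≤ t ^ 2 * v := by positivity
    have h := Real.abs_exp_sub_one_sub_id_le (x := -(t ^ 2 * v) / 2)
      (by rw [abs_le]; constructor <;> linarith)
    rw [← Complex.ofReal_exp, ← Complex.ofReal_sub, Complex.norm_real, Real.norm_eq_abs,
      abs_sub_comm]
    have e : Real.exp (-(t ^ 2 * v) / 2) - (1 - t ^ 2 * v / 2)
      = Real.exp (-(t ^ 2 * v) / 2) - 1 - -(t ^ 2 * v) / 2 := by ring
    rw [e]
    refine h.trans ?_
    have h4 : 0 ≤ t ^ 4 * v := by positivity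
    nlinarith [mul_le_mul_of_nonneg_left hvb h4, mul_nonneg h4 hv0]
  calc _ ≤ _ := norm_sub_le_norm_sub_add_norm_sub _ ((1 - t ^ 2 * v / 2 : ℝ) : ℂ) _
    _ ≤ |t| ^ 3 * b * v + t ^ 4 * b ^ 2 * v := add_le_add hA hB
    _ = _ := by ring

/-- Central limit theorem for row-wise independent, centered triangular arrays whose entries are
uniformly small and whose total variances converge. -/
theorem tendstoInDistribution_sum_of_bounded {Ω ι : Type*} [MeasurableSpace Ω] {μ : Measure Ω}
    [IsProbabilityMeasure μ] (Z : ℕ → ι → Ω → ℝ) (S : ℕ → Finset ι)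
    (hmeas : ∀ N p, AEMeasurable (Z N p) μ) (hindep : ∀ N, iIndepFun (Z N) μ)
    (b : ℕ → ℝ) (hb : Tendsto b atTop (𝓝 0))
    (hZb : ∀ N, ∀ p ∈ S N, ∀ᵐ ω ∂μ, |Z N p ω| ≤ b N) (h0 : ∀ N p, ∫ ω, Z N p ω ∂μ = 0)
    {v : ℝ} (hv : 0 ≤ v)
    (hvar : Tendsto (fun N => ∑ p ∈ S N, ∫ ω, Z N p ω ^ 2 ∂μ) atTop (𝓝 v)) :
    TendstoInDistribution (fun N ω => ∑ p ∈ S N, Z N p ω) atTop id (fun _ => μ)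
      (gaussianReal 0 v.toNNReal) where
  forall_aemeasurable N := Finset.aemeasurable_fun_sum _ fun p _ => hmeas N p
  tendsto := by
    refine ProbabilityMeasure.tendsto_iff_tendsto_charFun.2 fun t => ?_
    -- compare with the Gaussian of the same variance as the row, whose variance converges to `v`
    have hlim : charFun ((gaussianReal 0 v.toNNReal).map id) t
        = Complex.exp (-(t ^ 2 * v) / 2 : ℝ) := by
      rw [Measure.map_id, charFun_gaussianReal, Real.coe_toNNReal _ hv]
      congr 1
      push_cast
      ring
    simp only [ProbabilityMeasure.coe_mk, hlim]
    have hg : Tendsto (fun N => Complex.exp (-(t ^ 2 * ∑ p ∈ S N, ∫ ω, Z N p ω ^ 2 ∂μ) / 2 : ℝ))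
        atTop (𝓝 (Complex.exp (-(t ^ 2 * v) / 2 : ℝ))) := by
      refine (Complex.continuous_exp.tendsto _).comp
        ((Complex.continuous_ofReal.tendsto _).comp ?_)
      exact ((hvar.const_mul _).neg).div_const 2
    have hb' : Tendsto (fun N => |b N|) atTop (𝓝 0) := by simpa using hb.abs
    have hδ : Tendsto (fun N => (|t| ^ 3 * |b N| + t ^ 4 * |b N| ^ 2)
        * ∑ p ∈ S N, ∫ ω, Z N p ω ^ 2 ∂μ) atTop (𝓝 0) := by
      have := ((hb'.const_mul (|t| ^ 3)).add ((hb'.pow 2).const_mul (t ^ 4))).mul hvar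
      simpa using this
    have hsmall : ∀ᶠ N in atTop, |t| * |b N| ≤ 1 := by
      have := hb'.const_mul |t|
      rw [mul_zero] at this
      exact (this.eventually (gt_mem_nhds one_pos)).mono fun N h => h.le
    have hdiff : Tendsto (fun N => charFun (μ.map fun ω => ∑ p ∈ S N, Z N p ω) t
        - Complex.exp (-(t ^ 2 * ∑ p ∈ S N, ∫ ω, Z N p ω ^ 2 ∂μ) / 2 : ℝ)) atTop (𝓝 0) := by
      refine squeeze_zero_norm' ?_ hδ
      filter_upwards [hsmall] with N hN
      rw [((hindep N).restrict (S N)).charFun_map_fun_finsetSum_eq_prod (fun p _ => hmeas N p),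
        Finset.prod_apply]
      have e : Complex.exp (-(t ^ 2 * ∑ p ∈ S N, ∫ ω, Z N p ω ^ 2 ∂μ) / 2 : ℝ)
          = ∏ p ∈ S N, Complex.exp (-(t ^ 2 * ∫ ω, Z N p ω ^ 2 ∂μ) / 2 : ℝ) := by
        rw [← Complex.exp_sum, ← Complex.ofReal_sum]
        congr 2
        rw [Finset.mul_sum, ← Finset.sum_neg_distrib, Finset.sum_div]
      rw [e, Finset.mul_sum]
      refine (norm_prod_sub_prod_le_sum _ _ _ ?_ ?_).trans (Finset.sum_le_sum fun p hp => ?_)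
      · intro p _
        have := Measure.isProbabilityMeasure_map (hmeas N p)
        exact norm_charFun_le_one _
      · intro p _
        rw [← Complex.ofReal_exp, Complex.norm_real, Real.norm_eq_abs, Real.abs_exp,
          Real.exp_le_one_iff]
        have : 0 ≤ t ^ 2 * ∫ ω, Z N p ω ^ 2 ∂μ :=
          mul_nonneg (sq_nonneg t) (integral_nonneg fun ω => sq_nonneg _)
        linarith
      · refine norm_charFun_sub_exp_le (hmeas N p) (abs_nonneg _) ?_ (h0 N p) hN
        filter_upwards [hZb N p hp] with ω hω
        exact hω.trans (le_abs_self _)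
    simpa using hdiff.add hg

namespace GMMD

/-! ### Features and mean embeddings -/

section Embedding

variable {𝒳 : Type*} {H : Type*} [NormedAddCommGroup H] [InnerProductSpace ℝ H]
  [CompleteSpace H] [RKHS ℝ H 𝒳 ℝ]

lemma inner_feature (x : 𝒳) (f : H) : inner ℝ (feature H x) f = f x := by
  simp [feature]

lemma inner_feature_feature (x y : 𝒳) :
    inner ℝ (feature H x) (feature H y) = ker H x y := by
  rw [inner_feature, feature, RKHS.kerFun_apply, ker]

lemma exists_norm_feature_le
    (hA1 : BddAbove (Set.range (fun p : 𝒳 × 𝒳 => ker H p.1 p.2))) :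
    ∃ B : ℝ, 0 ≤ B ∧ ∀ x : 𝒳, ‖feature H x‖ ≤ B := by
  obtain ⟨C, hC⟩ := hA1
  refine ⟨√C, Real.sqrt_nonneg _, fun x => Real.le_sqrt_of_sq_le ?_⟩
  rw [← real_inner_self_eq_norm_sq, inner_feature_feature]
  exact hC ⟨(x, x), rfl⟩

lemma abs_apply_le {B : ℝ} (hB : ∀ x : 𝒳, ‖feature H x‖ ≤ B) (f : H) (x : 𝒳) :
    |f x| ≤ B * ‖f‖ := by
  rw [← inner_feature x f]
  exact (abs_real_inner_le_norm _ _).trans (mul_le_mul_of_nonneg_right (hB x) (norm_nonneg _))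

variable [MeasurableSpace 𝒳]

lemma measurable_ker_left (hK : Measurable (fun p : 𝒳 × 𝒳 => ker H p.1 p.2)) (y : 𝒳) :
    Measurable (fun x => ker H x y) := by
  have h := hK.comp (measurable_prodMk_right (y := y))
  exact h

/-- If the kernel is measurable then so is every function of `H`: the kernel functions span a dense
subspace, and convergence in `H` is pointwise. -/
lemma measurable_apply (hK : Measurable (fun p : 𝒳 × 𝒳 => ker H p.1 p.2)) (f : H) :
    Measurable (fun x => f x) := by
  let W : Submodule ℝ H :=
    { carrier := {f : H | Measurable (fun x => f x)}
      add_mem' := by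
        intro f g hf hg
        simp only [Set.mem_ofPred_eq, RKHS.coe_add]
        exact Measurable.add hf hg
      zero_mem' := by simp [measurable_const]
      smul_mem' := by
        intro c f hf
        simpa using Measurable.const_mul hf c }
  have hspan : Submodule.span ℝ {RKHS.kerFun H x v | (x : 𝒳) (v : ℝ)} ≤ W := by
    rw [Submodule.span_le]
    rintro _ ⟨y, v, rfl⟩
    have h : RKHS.kerFun H y v = v • feature H y := by
      rw [feature, ← map_smul, smul_eq_mul, mul_one]
    rw [h]
    refine W.smul_mem v ?_
    change Measurable (fun x => (feature H y : H) x)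
    have h2 : (fun x => (feature H y : H) x) = fun x => ker H x y := by
      ext x
      rw [← inner_feature_feature, inner_feature]
    rw [h2]
    exact measurable_ker_left hK y
  have hf : f ∈ (⊤ : Submodule ℝ H) := Submodule.mem_top
  rw [← RKHS.kerFun_dense (𝕜 := ℝ) (X := 𝒳) (V := ℝ) H, ← SetLike.mem_coe,
    Submodule.topologicalClosure_coe, mem_closure_iff_seq_limit] at hf
  obtain ⟨u, hu, hlim⟩ := hf
  refine measurable_of_tendsto_metrizable (fun i => (hspan (hu i) : Measurable (fun x => u i x))) ?_
  rw [tendsto_pi_nhds]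
  intro x
  exact ((RKHS.continuous_eval (𝕜 := ℝ) x).tendsto f).comp hlim

lemma integrable_apply (hK : Measurable (fun p : 𝒳 × 𝒳 => ker H p.1 p.2))
    {B : ℝ} (hB : ∀ x : 𝒳, ‖feature H x‖ ≤ B) (P : Measure 𝒳) [IsFiniteMeasure P] (f : H) :
    Integrable (fun x => f x) P :=
  Integrable.of_bound (measurable_apply hK f).aestronglyMeasurable (B * ‖f‖)
    (ae_of_all _ fun x => abs_apply_le hB f x)

/-- For a bounded measurable kernel the mean embedding exists: it represents the bounded linear
functional `f ↦ ∫ f dP`. -/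
lemma isMeanEmbedding_meanEmbedding (hK : Measurable (fun p : 𝒳 × 𝒳 => ker H p.1 p.2))
    {B : ℝ} (hB : ∀ x : 𝒳, ‖feature H x‖ ≤ B) (P : Measure 𝒳) [IsProbabilityMeasure P] :
    IsMeanEmbedding H P (meanEmbedding H P) := by
  have hex : ∃ m : H, IsMeanEmbedding H P m := by
    let L : H →ₗ[ℝ] ℝ :=
      { toFun := fun f => ∫ x, f x ∂P
        map_add' := fun f g => by
          simpa using integral_add (integrable_apply hK hB P f) (integrable_apply hK hB P g)
        map_smul' := fun c f => by
          simpa using integral_const_mul c (fun x => f x) }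
    let L' : H →L[ℝ] ℝ := L.mkContinuous B fun f => by
      have := norm_integral_le_of_norm_le_const (μ := P) (f := fun x => f x)
        (ae_of_all _ fun x => abs_apply_le hB f x)
      simpa [L] using this
    refine ⟨(InnerProductSpace.toDual ℝ H).symm L', fun f => ⟨integrable_apply hK hB P f, ?_⟩⟩
    rw [InnerProductSpace.toDual_symm_apply]
    rfl
  rw [meanEmbedding, dif_pos hex]
  exact hex.choose_spec

/-- The centred feature `K(x, ·) - m`, where `m` is the mean embedding of `P`. -/
noncomputable def centredFeature (H : Type*) [NormedAddCommGroup H] [InnerProductSpace ℝ H]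
    [CompleteSpace H] [RKHS ℝ H 𝒳 ℝ] (P : Measure 𝒳) (x : 𝒳) : H :=
  feature H x - meanEmbedding H P

lemma norm_meanEmbedding_le (hK : Measurable (fun p : 𝒳 × 𝒳 => ker H p.1 p.2))
    {B : ℝ} (hB0 : 0 ≤ B) (hB : ∀ x : 𝒳, ‖feature H x‖ ≤ B) (P : Measure 𝒳)
    [IsProbabilityMeasure P] : ‖meanEmbedding H P‖ ≤ B := by
  have h := (isMeanEmbedding_meanEmbedding hK hB P (meanEmbedding H P)).2
  have h2 := norm_integral_le_of_norm_le_const (μ := P) (f := fun x => meanEmbedding H P x)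
    (ae_of_all _ fun x => abs_apply_le hB (meanEmbedding H P) x)
  rw [← h, real_inner_self_eq_norm_sq, norm_pow, norm_norm] at h2
  simp only [probReal_univ, mul_one] at h2
  by_contra hlt
  push Not at hlt
  nlinarith [norm_nonneg (meanEmbedding H P)]

lemma norm_centredFeature_le (hK : Measurable (fun p : 𝒳 × 𝒳 => ker H p.1 p.2))
    {B : ℝ} (hB0 : 0 ≤ B) (hB : ∀ x : 𝒳, ‖feature H x‖ ≤ B) (P : Measure 𝒳)
    [IsProbabilityMeasure P] (x : 𝒳) : ‖centredFeature H P x‖ ≤ 2 * B :=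
  (norm_sub_le _ _).trans (by linarith [hB x, norm_meanEmbedding_le hK hB0 hB P])

lemma inner_centredFeature (P : Measure 𝒳) (x : 𝒳) (f : H) :
    inner ℝ (centredFeature H P x) f = f x - inner ℝ (meanEmbedding H P) f := by
  rw [centredFeature, inner_sub_left, inner_feature]

lemma measurable_inner_centredFeature (hK : Measurable (fun p : 𝒳 × 𝒳 => ker H p.1 p.2))
    (P : Measure 𝒳) (f : H) : Measurable (fun x => inner ℝ (centredFeature H P x) f) := by
  simp_rw [inner_centredFeature]
  exact (measurable_apply hK f).sub_const _

lemma integral_inner_centredFeature (hK : Measurable (fun p : 𝒳 × 𝒳 => ker H p.1 p.2))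
    {B : ℝ} (hB : ∀ x : 𝒳, ‖feature H x‖ ≤ B) (P : Measure 𝒳) [IsProbabilityMeasure P] (f : H) :
    ∫ x, inner ℝ (centredFeature H P x) f ∂P = 0 := by
  simp_rw [inner_centredFeature]
  rw [integral_sub (integrable_apply hK hB P f) (integrable_const _),
    (isMeanEmbedding_meanEmbedding hK hB P f).2]
  simp

lemma abs_inner_centredFeature_le (hK : Measurable (fun p : 𝒳 × 𝒳 => ker H p.1 p.2))
    {B : ℝ} (hB0 : 0 ≤ B) (hB : ∀ x : 𝒳, ‖feature H x‖ ≤ B) (P : Measure 𝒳)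
    [IsProbabilityMeasure P] (x : 𝒳) (f : H) :
    |inner ℝ (centredFeature H P x) f| ≤ 2 * B * ‖f‖ :=
  (abs_real_inner_le_norm _ _).trans
    (mul_le_mul_of_nonneg_right (norm_centredFeature_le hK hB0 hB P x) (norm_nonneg _))

lemma measurable_inner_centredFeature_centredFeature
    (hK : Measurable (fun p : 𝒳 × 𝒳 => ker H p.1 p.2)) (P : Measure 𝒳) :
    Measurable (fun p : 𝒳 × 𝒳 =>
      inner ℝ (centredFeature H P p.1) (centredFeature H P p.2)) := by
  have : ∀ p : 𝒳 × 𝒳, inner ℝ (centredFeature H P p.1) (centredFeature H P p.2)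
      = ker H p.1 p.2 - meanEmbedding H P p.1 - inner ℝ (centredFeature H P p.2)
        (meanEmbedding H P) := by
    intro p
    rw [real_inner_comm (meanEmbedding H P) (centredFeature H P p.2), centredFeature,
      inner_sub_left]
    congr 1
    rw [centredFeature, inner_sub_right, inner_feature_feature, inner_feature]
  simp_rw [this]
  exact (hK.sub ((measurable_apply hK _).comp measurable_fst)).sub
    ((measurable_inner_centredFeature hK P _).comp measurable_snd)

variable {Ω : Type*} [MeasurableSpace Ω] {μ : Measure Ω} [IsProbabilityMeasure μ]

/-- Centred features of independent variables are orthogonal in the mean. This is Fubini's theorem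
for the (jointly measurable) kernel, so that no separability of `H` is needed. -/
lemma integral_inner_centredFeature_of_indepFun
    (hK : Measurable (fun p : 𝒳 × 𝒳 => ker H p.1 p.2))
    {B : ℝ} (hB0 : 0 ≤ B) (hB : ∀ x : 𝒳, ‖feature H x‖ ≤ B) {P : Measure 𝒳}
    [IsProbabilityMeasure P] {Y Y' : Ω → 𝒳} (hY : HasLaw Y P μ) (hY' : HasLaw Y' P μ)
    (hind : IndepFun Y Y' μ) :
    ∫ ω, inner ℝ (centredFeature H P (Y ω)) (centredFeature H P (Y' ω)) ∂μ = 0 := by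
  have hm := measurable_inner_centredFeature_centredFeature hK P
  have hmap := (indepFun_iff_map_prod_eq_prod_map_map hY.aemeasurable hY'.aemeasurable).1 hind
  rw [hY.map_eq, hY'.map_eq] at hmap
  have h1 := integral_map (hY.aemeasurable.prodMk hY'.aemeasurable)
    (f := fun p : 𝒳 × 𝒳 => inner ℝ (centredFeature H P p.1) (centredFeature H P p.2))
    (hm.aestronglyMeasurable)
  rw [← h1, hmap, integral_prod]
  · refine integral_eq_zero_of_ae (ae_of_all _ fun x => ?_)
    exact (integral_congr_ae (ae_of_all _ fun y => real_inner_comm _ _)).trans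
      (integral_inner_centredFeature hK hB P (centredFeature H P x))
  · refine Integrable.of_bound hm.aestronglyMeasurable (2 * B * (2 * B)) (ae_of_all _ fun p => ?_)
    refine (abs_inner_centredFeature_le hK hB0 hB P _ _).trans ?_
    gcongr
    exact norm_centredFeature_le hK hB0 hB P _

/-- Second moment bound for weighted sums of centred features of an i.i.d. sample. -/
lemma integral_norm_sum_centredFeature_sq_le
    (hK : Measurable (fun p : 𝒳 × 𝒳 => ker H p.1 p.2))
    {B : ℝ} (hB0 : 0 ≤ B) (hB : ∀ x : 𝒳, ‖feature H x‖ ≤ B) {P : Measure 𝒳}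
    [IsProbabilityMeasure P] {Y : ℕ → Ω → 𝒳} (hY : ∀ i, HasLaw (Y i) P μ)
    (hind : Pairwise fun i j => IndepFun (Y i) (Y j) μ) (S : Finset ℕ) (a : ℕ → ℝ) :
    Integrable (fun ω => ‖∑ i ∈ S, a i • centredFeature H P (Y i ω)‖ ^ 2) μ ∧
    ∫ ω, ‖∑ i ∈ S, a i • centredFeature H P (Y i ω)‖ ^ 2 ∂μ ≤ (2 * B) ^ 2 * ∑ i ∈ S, a i ^ 2 := by
  have hexp : ∀ ω, ‖∑ i ∈ S, a i • centredFeature H P (Y i ω)‖ ^ 2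
      = ∑ i ∈ S, ∑ j ∈ S, a i * a j *
        inner ℝ (centredFeature H P (Y i ω)) (centredFeature H P (Y j ω)) := by
    intro ω
    rw [← real_inner_self_eq_norm_sq, sum_inner]
    refine Finset.sum_congr rfl fun i _ => ?_
    rw [inner_sum]
    refine Finset.sum_congr rfl fun j _ => ?_
    rw [real_inner_smul_left, real_inner_smul_right, mul_assoc]
  have hbd : ∀ x y, |inner ℝ (centredFeature H P x) (centredFeature H P y)| ≤ (2 * B) ^ 2 := by
    intro x y
    refine (abs_inner_centredFeature_le hK hB0 hB P _ _).trans ?_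
    rw [sq]
    gcongr
    exact norm_centredFeature_le hK hB0 hB P _
  have hint : ∀ i j, Integrable (fun ω => a i * a j *
      inner ℝ (centredFeature H P (Y i ω)) (centredFeature H P (Y j ω))) μ := by
    intro i j
    refine Integrable.const_mul (Integrable.of_bound ?_ ((2 * B) ^ 2)
      (ae_of_all _ fun ω => hbd _ _)) _
    exact ((measurable_inner_centredFeature_centredFeature hK P).comp_aemeasurable
      ((hY i).aemeasurable.prodMk (hY j).aemeasurable)).aestronglyMeasurable
  simp_rw [hexp]
  refine ⟨integrable_finsetSum _ fun i _ => integrable_finsetSum _ fun j _ => hint i j, ?_⟩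
  rw [integral_finsetSum _ fun i _ => integrable_finsetSum _ fun j _ => hint i j, Finset.mul_sum]
  refine Finset.sum_le_sum fun i hi => ?_
  rw [integral_finsetSum _ fun j _ => hint i j, Finset.sum_eq_single_of_mem i hi]
  · rw [integral_const_mul, ← sq, mul_comm]
    gcongr
    have := norm_integral_le_of_norm_le_const (μ := μ)
      (f := fun ω => inner ℝ (centredFeature H P (Y i ω)) (centredFeature H P (Y i ω)))
      (ae_of_all _ fun ω => hbd _ _)
    simpa using (le_abs_self _).trans this
  · intro j _ hj
    rw [integral_const_mul, integral_inner_centredFeature_of_indepFun hK hB0 hB (hY i) (hY j)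
      (hind hj.symm), mul_zero]

end Embedding

/-! ### Linearization of the estimator -/

section Linearization

variable {H : Type*} [NormedAddCommGroup H] [InnerProductSpace ℝ H]

/-- The part of `‖m + D‖² + ‖m' + D'‖² - 2 ⟪m + E, m' + D'⟫` that is linear in the fluctuations
`D`, `D'`, `E`. -/
noncomputable def linearPart (m m' D D' E : H) : ℝ :=
  2 * inner ℝ m D + 2 * inner ℝ m' D' - 2 * inner ℝ m D' - 2 * inner ℝ E m'

/-- The error of the linearization of one summand of the estimator. The weight error `p - r` and
the error `κ - 1` of the mean weight meet bounded factors only; all other terms are quadratic in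
the fluctuations. -/
lemma abs_summand_sub_linearPart_le (m m' D D' E : H) {p r κ w B C : ℝ} (hw : 0 ≤ w)
    (hp0 : 0 ≤ p) (hp1 : p ≤ 1) (hm : ‖m‖ ≤ B) (hm' : ‖m'‖ ≤ B) (hD : ‖D‖ ≤ 2 * B)
    (hD' : ‖D'‖ ≤ 2 * B) (hE : ‖E‖ ≤ C) :
    |w * (p * (‖m + D‖ ^ 2 + ‖m' + D'‖ ^ 2 - 2 * inner ℝ (κ • m + E) (m' + D'))
        - r * ‖m - m'‖ ^ 2 - r * linearPart m m' D D' E)|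
      ≤ |w * (p - r)| * (16 * B ^ 2 + 2 * B * C)
        + w * (‖D‖ ^ 2 + 2 * ‖D'‖ ^ 2 + ‖E‖ ^ 2) + w * |κ - 1| * (6 * B ^ 2) := by
  have hB : 0 ≤ B := (norm_nonneg m).trans hm
  have hC : 0 ≤ C := (norm_nonneg E).trans hE
  have key : w * (p * (‖m + D‖ ^ 2 + ‖m' + D'‖ ^ 2 - 2 * inner ℝ (κ • m + E) (m' + D'))
        - r * ‖m - m'‖ ^ 2 - r * linearPart m m' D D' E)
      = w * (p - r) * (‖m - m'‖ ^ 2 + linearPart m m' D D' E)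
        + w * (p * (‖D‖ ^ 2 + ‖D'‖ ^ 2 - 2 * inner ℝ E D'))
        - p * (w * (κ - 1) * (2 * inner ℝ m (m' + D'))) := by
    simp only [linearPart, norm_add_sq_real, norm_sub_sq_real, inner_add_left, inner_add_right,
      real_inner_smul_left]
    ring
  have hmul : ∀ (x y : H) (a b : ℝ), ‖x‖ ≤ a → ‖y‖ ≤ b → |inner ℝ x y| ≤ a * b := by
    intro x y a b hx hy
    exact (abs_real_inner_le_norm x y).trans
      (mul_le_mul hx hy (norm_nonneg _) ((norm_nonneg _).trans hx))
  have h1 : |‖m - m'‖ ^ 2 + linearPart m m' D D' E| ≤ 16 * B ^ 2 + 2 * B * C := by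
    have e1 := abs_le.1 (hmul m D _ _ hm hD)
    have e2 := abs_le.1 (hmul m' D' _ _ hm' hD')
    have e3 := abs_le.1 (hmul m D' _ _ hm hD')
    have e4 := abs_le.1 (hmul E m' _ _ hE hm')
    have e5 : ‖m - m'‖ ^ 2 ≤ (2 * B) ^ 2 := by
      have : ‖m - m'‖ ≤ 2 * B := (norm_sub_le _ _).trans (by linarith)
      gcongr
    have e6 := sq_nonneg ‖m - m'‖
    rw [abs_le, linearPart]
    constructor <;> nlinarith
  have h2 : |p * (‖D‖ ^ 2 + ‖D'‖ ^ 2 - 2 * inner ℝ E D')|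
      ≤ ‖D‖ ^ 2 + 2 * ‖D'‖ ^ 2 + ‖E‖ ^ 2 := by
    have e1 := abs_le.1 (hmul E D' _ _ le_rfl le_rfl)
    have e2 := sq_nonneg (‖E‖ - ‖D'‖)
    rw [abs_mul, abs_of_nonneg hp0]
    refine (mul_le_of_le_one_left (abs_nonneg _) hp1).trans ?_
    rw [abs_le]
    constructor <;> nlinarith [sq_nonneg ‖D‖, sq_nonneg ‖D'‖, sq_nonneg ‖E‖]
  have h3 : |2 * inner ℝ m (m' + D')| ≤ 6 * B ^ 2 := by
    have := hmul m (m' + D') B (3 * B) hm ((norm_add_le _ _).trans (by linarith))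
    rw [abs_mul, abs_two]
    nlinarith
  rw [key]
  refine (abs_sub _ _).trans (add_le_add ((abs_add_le _ _).trans (add_le_add ?_ ?_)) ?_)
  · rw [abs_mul]
    gcongr
  · rw [abs_mul, abs_of_nonneg hw]
    gcongr
  · rw [abs_mul, abs_of_nonneg hp0]
    refine (mul_le_of_le_one_left (abs_nonneg _) hp1).trans ?_
    rw [abs_mul, abs_mul, abs_of_nonneg hw]
    gcongr

/-- Collecting the linear parts of all pairs `(j, l)`, sample by sample, produces the vectors that
define `𝒰ⱼ` and `𝒱ⱼ`. -/
lemma sum_linearPart {s : ℕ} (m D E : Fin s → H) (ρ : Fin s → ℝ) (hρ : ∑ j, ρ j = 1) :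
    ∑ j, ∑ l ∈ Finset.univ.erase j, ρ l * linearPart (m j) (m l) (D j) (D l) (E j)
      = ∑ j, (2 * inner ℝ (D j)
            ((1 - 2 * ρ j + s * ρ j) • m j + ρ j • (m j - ∑ i, m i))
          - 2 * inner ℝ (E j) (∑ i, ρ i • m i - ρ j • m j)) := by
  have hfull : ∑ j, ∑ l, ρ l * linearPart (m j) (m l) (D j) (D l) (E j)
      = ∑ j, (2 * inner ℝ (m j) (D j) + s * (ρ j * (2 * inner ℝ (m j) (D j)))
        - ρ j * (2 * inner ℝ (D j) (∑ i, m i)) - 2 * inner ℝ (E j) (∑ i, ρ i • m i)) := by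
    have hsplit : ∀ j l, ρ l * linearPart (m j) (m l) (D j) (D l) (E j)
        = ρ l * (2 * inner ℝ (m j) (D j)) + ρ l * (2 * inner ℝ (m l) (D l))
          - ρ l * (2 * inner ℝ (D l) (m j)) - 2 * inner ℝ (E j) (ρ l • m l) := by
      intro j l
      rw [linearPart, real_inner_smul_right, real_inner_comm (D l) (m j)]
      ring
    simp_rw [hsplit, Finset.sum_sub_distrib, Finset.sum_add_distrib, inner_sum, Finset.mul_sum]
    congr 2
    · congr 1
      · simp_rw [← Finset.sum_mul, hρ, one_mul]
      · simp [Finset.mul_sum]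
    · rw [Finset.sum_comm]
  simp_rw [Finset.sum_erase_eq_sub (Finset.mem_univ _)]
  rw [Finset.sum_sub_distrib, hfull, ← Finset.sum_sub_distrib]
  refine Finset.sum_congr rfl fun j _ => ?_
  simp only [linearPart, inner_add_right, inner_sub_right, real_inner_smul_right]
  rw [real_inner_comm (m j) (D j)]
  ring

end Linearization

section Estimator

variable {𝒳 : Type*} {H : Type*} [NormedAddCommGroup H] [InnerProductSpace ℝ H]
  [CompleteSpace H] [RKHS ℝ H 𝒳 ℝ] [MeasurableSpace 𝒳]

/-- The weighted mean `r⁻¹ ∑_{i=1}^r aᵢ (K(xᵢ, ·) - m)` of centred features. -/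
noncomputable def centredMean (H : Type*) [NormedAddCommGroup H] [InnerProductSpace ℝ H]
    [CompleteSpace H] [RKHS ℝ H 𝒳 ℝ] (P : Measure 𝒳) (r : ℕ) (a : ℕ → ℝ) (x : ℕ → 𝒳) : H :=
  (r : ℝ)⁻¹ • ∑ i ∈ Finset.Icc 1 r, a i • centredFeature H P (x i)

/-- The vector whose inner product with the centred feature is `𝒰ⱼ`. -/
noncomputable def uVec (H : Type*) [NormedAddCommGroup H] [InnerProductSpace ℝ H]
    [CompleteSpace H] [RKHS ℝ H 𝒳 ℝ] {s : ℕ} (P : Fin s → Measure 𝒳) (ρ : Fin s → ℝ)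
    (j : Fin s) : H :=
  (1 - 2 * ρ j + s * ρ j) • meanEmbedding H (P j) + ρ j • (meanEmbedding H (P j) - sumMean H P)

/-- The vector whose inner product with the centred feature is `𝒱ⱼ`. -/
noncomputable def vVec (H : Type*) [NormedAddCommGroup H] [InnerProductSpace ℝ H]
    [CompleteSpace H] [RKHS ℝ H 𝒳 ℝ] {s : ℕ} (P : Fin s → Measure 𝒳) (ρ : Fin s → ℝ)
    (j : Fin s) : H :=
  mixMean H P ρ - ρ j • meanEmbedding H (P j)

lemma empMean_eq (P : Measure 𝒳) {r : ℕ} (hr : r ≠ 0) (x : ℕ → 𝒳) :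
    empMean H r x = meanEmbedding H P + centredMean H P r (fun _ => 1) x := by
  have hr' : (r : ℝ) ≠ 0 := Nat.cast_ne_zero.2 hr
  simp only [empMean, centredMean, centredFeature, one_smul, Finset.sum_sub_distrib,
    Finset.sum_const, Nat.card_Icc, Nat.add_sub_cancel, smul_sub]
  rw [← Nat.cast_smul_eq_nsmul ℝ, smul_smul, inv_mul_cancel₀ hr', one_smul]
  abel

/-- The weighted empirical mean is `κ m + E`, with `κ` the mean weight and `E` the weighted
fluctuation. -/
lemma sum_mul_inner_feature_eq (P : Measure 𝒳) (r : ℕ) (a : ℕ → ℝ) (x : ℕ → 𝒳) (f : H) :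
    2 / (r : ℝ) * ∑ i ∈ Finset.Icc 1 r, a i * inner ℝ (feature H (x i)) f
      = 2 * inner ℝ ((1 / (r : ℝ) * ∑ i ∈ Finset.Icc 1 r, a i) • meanEmbedding H P
          + centredMean H P r a x) f := by
  have h : ∀ i, inner ℝ (feature H (x i)) f
      = inner ℝ (meanEmbedding H P) f + inner ℝ (centredFeature H P (x i)) f := by
    intro i
    rw [← inner_add_left, centredFeature, add_sub_cancel]
  simp_rw [h, mul_add, Finset.sum_add_distrib, ← Finset.sum_mul]
  rw [inner_add_left, real_inner_smul_left, centredMean, real_inner_smul_left, sum_inner]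
  simp_rw [real_inner_smul_left]
  ring

lemma norm_centredMean_le (hK : Measurable (fun p : 𝒳 × 𝒳 => ker H p.1 p.2))
    {B : ℝ} (hB0 : 0 ≤ B) (hB : ∀ x : 𝒳, ‖feature H x‖ ≤ B) (P : Measure 𝒳)
    [IsProbabilityMeasure P] {r : ℕ} {a : ℕ → ℝ} {c : ℝ} (hc : 0 ≤ c)
    (ha : ∀ i ∈ Finset.Icc 1 r, |a i| ≤ c) (x : ℕ → 𝒳) :
    ‖centredMean H P r a x‖ ≤ c * (2 * B) := by
  rcases Nat.eq_zero_or_pos r with rfl | hr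
  · simp [centredMean]
    positivity
  have hr' : (0 : ℝ) < r := Nat.cast_pos.2 hr
  rw [centredMean, norm_smul, norm_inv, Real.norm_natCast, inv_mul_le_iff₀ hr']
  refine (norm_sum_le _ _).trans ?_
  have : ∀ i ∈ Finset.Icc 1 r, ‖a i • centredFeature H P (x i)‖ ≤ c * (2 * B) := by
    intro i hi
    rw [norm_smul]
    exact mul_le_mul (ha i hi) (norm_centredFeature_le hK hB0 hB P _) (norm_nonneg _) hc
  simpa using Finset.sum_le_sum this

/-- The contribution of observation `i` of sample `j` to the linearization of the centred and
scaled estimator. -/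
noncomputable def linearTerm (H : Type*) [NormedAddCommGroup H] [InnerProductSpace ℝ H]
    [CompleteSpace H] [RKHS ℝ H 𝒳 ℝ] {s : ℕ} (P : Fin s → Measure 𝒳) (ρ : Fin s → ℝ)
    (n : Fin s → ℕ) (k : ℕ → ℕ → ℝ) (p : Σ _ : Fin s, ℕ) (x : 𝒳) : ℝ :=
  2 * (√(total n : ℝ) / n p.1) * (U H P ρ p.1 x - k (n p.1) p.2 * V H P ρ p.1 x)

lemma sum_linearTerm {s : ℕ} (P : Fin s → Measure 𝒳) (ρ : Fin s → ℝ)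
    (n : Fin s → ℕ) (k : ℕ → ℕ → ℝ) (x : Fin s → ℕ → 𝒳) :
    ∑ p ∈ Finset.univ.sigma fun j => Finset.Icc 1 (n j), linearTerm H P ρ n k p (x p.1 p.2)
      = √(total n : ℝ) * ∑ j,
        (2 * inner ℝ (centredMean H (P j) (n j) (fun _ => 1) (x j)) (uVec H P ρ j)
          - 2 * inner ℝ (centredMean H (P j) (n j) (k (n j)) (x j)) (vVec H P ρ j)) := by
  rw [Finset.sum_sigma, Finset.mul_sum]
  refine Finset.sum_congr rfl fun j _ => ?_
  have hU : ∀ i, U H P ρ j (x j i) = inner ℝ (centredFeature H (P j) (x j i)) (uVec H P ρ j) :=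
    fun _ => rfl
  have hV : ∀ i, V H P ρ j (x j i) = inner ℝ (centredFeature H (P j) (x j i)) (vVec H P ρ j) :=
    fun _ => rfl
  simp_rw [linearTerm, hU, hV, ← Finset.mul_sum, Finset.sum_sub_distrib]
  rw [centredMean, centredMean, real_inner_smul_left, real_inner_smul_left, sum_inner, sum_inner]
  simp_rw [real_inner_smul_left, one_mul]
  ring

/-- A bound for the difference between the centred and scaled estimator and its linearization. -/
noncomputable def remainderBound (H : Type*) [NormedAddCommGroup H] [InnerProductSpace ℝ H]
    [CompleteSpace H] [RKHS ℝ H 𝒳 ℝ] {s : ℕ} (P : Fin s → Measure 𝒳) (ρ : Fin s → ℝ)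
    (B c : ℝ) (n : Fin s → ℕ) (k : ℕ → ℕ → ℝ) (x : Fin s → ℕ → 𝒳) : ℝ :=
  ∑ j, ∑ l ∈ Finset.univ.erase j,
    (|√(total n : ℝ) * (fraction n l - ρ l)| * (16 * B ^ 2 + 2 * B * (c * (2 * B)))
      + √(total n : ℝ) * (‖centredMean H (P j) (n j) (fun _ => 1) (x j)‖ ^ 2
        + 2 * ‖centredMean H (P l) (n l) (fun _ => 1) (x l)‖ ^ 2
        + ‖centredMean H (P j) (n j) (k (n j)) (x j)‖ ^ 2)
      + √(total n : ℝ) * |1 / (n j : ℝ) * ∑ i ∈ Finset.Icc 1 (n j), k (n j) i - 1|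
        * (6 * B ^ 2))

lemma fraction_nonneg {s : ℕ} (n : Fin s → ℕ) (j : Fin s) : 0 ≤ fraction n j := by
  unfold fraction
  positivity

lemma fraction_le_one {s : ℕ} (n : Fin s → ℕ) (j : Fin s) : fraction n j ≤ 1 := by
  refine div_le_one_of_le₀ ?_ (Nat.cast_nonneg _)
  exact_mod_cast Finset.single_le_sum (f := n) (fun _ _ => Nat.zero_le _) (Finset.mem_univ j)

/-- The bound on the linearization error holds pathwise, for every realization `x` of the samples. -/
lemma abs_estimator_sub_sum_linearTerm_le (hK : Measurable (fun p : 𝒳 × 𝒳 => ker H p.1 p.2))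
    {B : ℝ} (hB0 : 0 ≤ B) (hB : ∀ x : 𝒳, ‖feature H x‖ ≤ B) {s : ℕ} (P : Fin s → Measure 𝒳)
    [∀ j, IsProbabilityMeasure (P j)] (ρ : Fin s → ℝ) (hρ : ∑ j, ρ j = 1)
    (n : Fin s → ℕ) (hn : ∀ j, n j ≠ 0) (k : ℕ → ℕ → ℝ) {c : ℝ} (hc : 0 ≤ c)
    (hk : ∀ r, ∀ i ∈ Finset.Icc 1 r, |k r i| ≤ c) (x : Fin s → ℕ → 𝒳) :
    |√(total n : ℝ) * (estimator H n k x - gmmdSq H P ρ)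
        - ∑ p ∈ Finset.univ.sigma fun j => Finset.Icc 1 (n j), linearTerm H P ρ n k p (x p.1 p.2)|
      ≤ remainderBound H P ρ B c n k x := by
  have hlin := sum_linearPart (fun j => meanEmbedding H (P j))
    (fun j => centredMean H (P j) (n j) (fun _ => 1) (x j))
    (fun j => centredMean H (P j) (n j) (k (n j)) (x j)) ρ hρ
  have hsum : ∑ p ∈ Finset.univ.sigma fun j => Finset.Icc 1 (n j),
      linearTerm H P ρ n k p (x p.1 p.2) = √(total n : ℝ) *
        ∑ j, ∑ l ∈ Finset.univ.erase j, ρ l * linearPart (meanEmbedding H (P j))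
          (meanEmbedding H (P l)) (centredMean H (P j) (n j) (fun _ => 1) (x j))
          (centredMean H (P l) (n l) (fun _ => 1) (x l))
          (centredMean H (P j) (n j) (k (n j)) (x j)) := by
    rw [sum_linearTerm, hlin]
    rfl
  rw [hsum, estimator, gmmdSq, ← mul_sub, ← Finset.sum_sub_distrib, ← Finset.sum_sub_distrib]
  simp_rw [← Finset.sum_sub_distrib]
  rw [Finset.mul_sum, remainderBound]
  refine (Finset.abs_sum_le_sum_abs _ _).trans (Finset.sum_le_sum fun j _ => ?_)
  rw [Finset.mul_sum]
  refine (Finset.abs_sum_le_sum_abs _ _).trans (Finset.sum_le_sum fun l _ => ?_)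
  rw [sum_mul_inner_feature_eq (P j), empMean_eq (P j) (hn j), empMean_eq (P l) (hn l), MMD]
  refine abs_summand_sub_linearPart_le _ _ _ _ _ (Real.sqrt_nonneg _) (fraction_nonneg n l)
    (fraction_le_one n l) (norm_meanEmbedding_le hK hB0 hB _) (norm_meanEmbedding_le hK hB0 hB _)
    ?_ ?_ (norm_centredMean_le hK hB0 hB _ hc (hk (n j)) _)
  · simpa using norm_centredMean_le hK hB0 hB (P j) (r := n j) (a := fun _ => 1) zero_le_one
      (by simp) (x j)
  · simpa using norm_centredMean_le hK hB0 hB (P l) (r := n l) (a := fun _ => 1) zero_le_one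
      (by simp) (x l)

end Estimator

/-! ### Sample sizes and weights -/

section SampleSizes

variable {s : ℕ} {n : ℕ → Fin s → ℕ} {ρ : Fin s → ℝ}

lemma le_total (n : Fin s → ℕ) (j : Fin s) : n j ≤ total n :=
  Finset.single_le_sum (f := n) (fun _ _ => Nat.zero_le _) (Finset.mem_univ j)

lemma tendsto_sqrt_total [NeZero s] (hn : ∀ j, Tendsto (fun N => n N j) atTop atTop) :
    Tendsto (fun N => √(total (n N) : ℝ)) atTop atTop :=
  Real.tendsto_sqrt_atTop.comp <| tendsto_natCast_atTop_atTop.comp <|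
    tendsto_atTop_mono (fun N => le_total (n N) 0) (hn 0)

lemma tendsto_fraction [NeZero s] (hn : ∀ j, Tendsto (fun N => n N j) atTop atTop)
    (hA2 : ∀ j, Tendsto (fun N => √(total (n N) : ℝ) * (fraction (n N) j - ρ j)) atTop (𝓝 0))
    (j : Fin s) : Tendsto (fun N => fraction (n N) j) atTop (𝓝 (ρ j)) := by
  have h1 := ((tendsto_sqrt_total hn).inv_tendsto_atTop.mul (hA2 j)).add_const (ρ j)
  rw [mul_zero, zero_add] at h1
  refine h1.congr' ?_
  filter_upwards [(tendsto_sqrt_total hn).eventually_gt_atTop 0] with N hN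
  simp only [Pi.inv_apply]
  field_simp
  ring

/-- The limiting fractions sum to one, since the sample fractions do. -/
lemma sum_eq_one [NeZero s] (hn : ∀ j, Tendsto (fun N => n N j) atTop atTop)
    (hA2 : ∀ j, Tendsto (fun N => √(total (n N) : ℝ) * (fraction (n N) j - ρ j)) atTop (𝓝 0)) :
    ∑ j, ρ j = 1 := by
  have h1 : Tendsto (fun N => ∑ j, fraction (n N) j) atTop (𝓝 (∑ j, ρ j)) :=
    tendsto_finsetSum _ fun j _ => tendsto_fraction hn hA2 j
  refine tendsto_nhds_unique (h1.congr' ?_) tendsto_const_nhds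
  filter_upwards [(tendsto_sqrt_total hn).eventually_gt_atTop 0] with N hN
  have hpos : (0 : ℝ) < total (n N) := Real.sqrt_pos.1 hN
  simp only [fraction]
  rw [← Finset.sum_div, ← Nat.cast_sum]
  exact div_self hpos.ne'

lemma tendsto_total_div [NeZero s] (hn : ∀ j, Tendsto (fun N => n N j) atTop atTop)
    (hρ : ∀ j, 0 < ρ j)
    (hA2 : ∀ j, Tendsto (fun N => √(total (n N) : ℝ) * (fraction (n N) j - ρ j)) atTop (𝓝 0))
    (j : Fin s) : Tendsto (fun N => (total (n N) : ℝ) / n N j) atTop (𝓝 (ρ j)⁻¹) := by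
  refine ((tendsto_fraction hn hA2 j).inv₀ (hρ j).ne').congr fun N => ?_
  rw [fraction, inv_div]

lemma tendsto_sqrt_total_div [NeZero s] (hn : ∀ j, Tendsto (fun N => n N j) atTop atTop)
    (hρ : ∀ j, 0 < ρ j)
    (hA2 : ∀ j, Tendsto (fun N => √(total (n N) : ℝ) * (fraction (n N) j - ρ j)) atTop (𝓝 0))
    (j : Fin s) : Tendsto (fun N => √(total (n N) : ℝ) / n N j) atTop (𝓝 0) := by
  -- `√n / nⱼ = (√n)⁻¹ (n / nⱼ)`
  have h := (tendsto_sqrt_total hn).inv_tendsto_atTop.mul (tendsto_total_div hn hρ hA2 j)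
  rw [zero_mul] at h
  refine h.congr fun N => ?_
  simp only [Pi.inv_apply]
  rw [← mul_div_assoc, inv_mul_eq_div, Real.div_sqrt]

end SampleSizes

/-- The mean weights converge to one. -/
lemma tendsto_mean_weight {k : ℕ → ℕ → ℝ} {τ : ℝ} {n₀ : ℕ}
    (h : ∀ r : ℕ, n₀ < r → (r : ℝ) * |1 / (r : ℝ) * ∑ i ∈ Finset.Icc 1 r, k r i - 1| ≤ τ) :
    Tendsto (fun r : ℕ => 1 / (r : ℝ) * ∑ i ∈ Finset.Icc 1 r, k r i) atTop (𝓝 1) := by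
  rw [← tendsto_sub_nhds_zero_iff]
  refine squeeze_zero_norm' ?_ (tendsto_const_div_atTop_nhds_zero_nat τ)
  filter_upwards [eventually_gt_atTop n₀, eventually_gt_atTop 0] with r hr hr0
  rw [le_div_iff₀ (Nat.cast_pos.2 hr0), mul_comm]
  exact h r hr

/-! ### The remainder is negligible -/

/-- A family dominated by nonnegative variables whose means tend to zero tends to zero in
probability. -/
lemma tendstoInMeasure_zero_of_abs_le {Ω : Type*} [MeasurableSpace Ω] {μ : Measure Ω}
    {R G : ℕ → Ω → ℝ} (hR : ∀ N, AEMeasurable (R N) μ) (hG : ∀ N, Integrable (G N) μ)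
    (hRG : ∀ᶠ N in atTop, ∀ ω, |R N ω| ≤ G N ω)
    (hlim : Tendsto (fun N => ∫ ω, G N ω ∂μ) atTop (𝓝 0)) :
    TendstoInMeasure μ R atTop 0 := by
  refine tendstoInMeasure_of_tendsto_eLpNorm one_ne_zero (fun N => (hR N).aestronglyMeasurable)
    aestronglyMeasurable_zero ?_
  have h2 : Tendsto (fun N => ENNReal.ofReal (∫ ω, G N ω ∂μ)) atTop (𝓝 0) := by
    simpa using ENNReal.tendsto_ofReal hlim
  refine tendsto_of_tendsto_of_tendsto_of_le_of_le' tendsto_const_nhds h2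
    (Eventually.of_forall fun _ => zero_le) ?_
  filter_upwards [hRG] with N hN
  rw [sub_zero, eLpNorm_one_eq_lintegral_enorm, ofReal_integral_eq_lintegral_ofReal (hG N)
    (ae_of_all _ fun ω => (abs_nonneg _).trans (hN ω))]
  refine lintegral_mono fun ω => ?_
  rw [← ofReal_norm]
  exact ENNReal.ofReal_le_ofReal (hN ω)

section Probability

variable {𝒳 : Type*} {H : Type*} [NormedAddCommGroup H] [InnerProductSpace ℝ H]
  [CompleteSpace H] [RKHS ℝ H 𝒳 ℝ] [MeasurableSpace 𝒳]
  {Ω : Type*} [MeasurableSpace Ω] {μ : Measure Ω} [IsProbabilityMeasure μ]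

lemma integral_norm_centredMean_sq_le (hK : Measurable (fun p : 𝒳 × 𝒳 => ker H p.1 p.2))
    {B : ℝ} (hB0 : 0 ≤ B) (hB : ∀ x : 𝒳, ‖feature H x‖ ≤ B) {P : Measure 𝒳}
    [IsProbabilityMeasure P] {Y : ℕ → Ω → 𝒳} (hY : ∀ i, HasLaw (Y i) P μ)
    (hind : Pairwise fun i j => IndepFun (Y i) (Y j) μ) (r : ℕ) {a : ℕ → ℝ} {c : ℝ}
    (ha : ∀ i ∈ Finset.Icc 1 r, |a i| ≤ c) :
    Integrable (fun ω => ‖centredMean H P r a (fun i => Y i ω)‖ ^ 2) μ ∧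
    ∫ ω, ‖centredMean H P r a (fun i => Y i ω)‖ ^ 2 ∂μ ≤ (2 * B) ^ 2 * c ^ 2 / r := by
  have h := integral_norm_sum_centredFeature_sq_le hK hB0 hB hY hind (Finset.Icc 1 r) a
  have he : ∀ ω, ‖centredMean H P r a (fun i => Y i ω)‖ ^ 2
      = ((r : ℝ)⁻¹) ^ 2 * ‖∑ i ∈ Finset.Icc 1 r, a i • centredFeature H P (Y i ω)‖ ^ 2 := by
    intro ω
    rw [centredMean, norm_smul, mul_pow, norm_inv, Real.norm_natCast]
  simp_rw [he]
  refine ⟨h.1.const_mul _, ?_⟩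
  rw [integral_const_mul]
  have hs : ∑ i ∈ Finset.Icc 1 r, a i ^ 2 ≤ r * c ^ 2 := by
    have : ∀ i ∈ Finset.Icc 1 r, a i ^ 2 ≤ c ^ 2 := fun i hi => by
      rw [← sq_abs]
      have := ha i hi
      gcongr
    simpa using Finset.sum_le_sum this
  calc ((r : ℝ)⁻¹) ^ 2 * ∫ ω, ‖∑ i ∈ Finset.Icc 1 r, a i • centredFeature H P (Y i ω)‖ ^ 2 ∂μ
      ≤ ((r : ℝ)⁻¹) ^ 2 * ((2 * B) ^ 2 * (r * c ^ 2)) := by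
        gcongr
        exact h.2.trans (by gcongr)
    _ = (2 * B) ^ 2 * c ^ 2 / r := by
        rcases eq_or_ne (r : ℝ) 0 with h0 | h0
        · simp [h0]
        · field_simp

/-- `√n 𝔼 ‖r⁻¹ ∑ aᵢ (K(Xᵢ, ·) - m)‖² → 0` for the sample of size `r = nⱼ` and bounded weights. -/
lemma tendsto_sqrt_mul_integral_centredMean (hK : Measurable (fun p : 𝒳 × 𝒳 => ker H p.1 p.2))
    {B : ℝ} (hB0 : 0 ≤ B) (hB : ∀ x : 𝒳, ‖feature H x‖ ≤ B) {P : Measure 𝒳}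
    [IsProbabilityMeasure P] {Y : ℕ → Ω → 𝒳} (hY : ∀ i, HasLaw (Y i) P μ)
    (hind : Pairwise fun i j => IndepFun (Y i) (Y j) μ) {a : ℕ → ℕ → ℝ} {c : ℝ}
    (ha : ∀ r, ∀ i ∈ Finset.Icc 1 r, |a r i| ≤ c) {w : ℕ → ℝ} (hw : ∀ N, 0 ≤ w N) {r : ℕ → ℕ}
    (hr : Tendsto (fun N => w N / r N) atTop (𝓝 0)) :
    Tendsto (fun N => w N * ∫ ω, ‖centredMean H P (r N) (a (r N)) (fun i => Y i ω)‖ ^ 2 ∂μ)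
      atTop (𝓝 0) := by
  have h := hr.const_mul ((2 * B) ^ 2 * c ^ 2)
  rw [mul_zero] at h
  refine squeeze_zero (fun N => mul_nonneg (hw N) (integral_nonneg fun ω => sq_nonneg _))
    (fun N => ?_) h
  refine (mul_le_mul_of_nonneg_left
    (integral_norm_centredMean_sq_le hK hB0 hB hY hind (r N) (ha (r N))).2 (hw N)).trans ?_
  exact le_of_eq (by ring)

lemma integral_const_add_mul_add_const {f g h : Ω → ℝ} (hf : Integrable f μ)
    (hg : Integrable g μ) (hh : Integrable h μ) (a w b : ℝ) :
    Integrable (fun ω => a + w * (f ω + 2 * g ω + h ω) + b) μ ∧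
    ∫ ω, (a + w * (f ω + 2 * g ω + h ω) + b) ∂μ
      = a + (w * ∫ ω, f ω ∂μ + 2 * (w * ∫ ω, g ω ∂μ) + w * ∫ ω, h ω ∂μ) + b := by
  have h1 : Integrable (fun ω => f ω + 2 * g ω) μ := hf.add (hg.const_mul 2)
  have h2 : Integrable (fun ω => f ω + 2 * g ω + h ω) μ := h1.add hh
  have h3 : Integrable (fun ω => a + w * (f ω + 2 * g ω + h ω)) μ :=
    (integrable_const a).add (h2.const_mul w)
  refine ⟨h3.add (integrable_const b), ?_⟩
  rw [integral_add h3 (integrable_const b), integral_add (integrable_const a) (h2.const_mul w),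
    integral_const_mul, integral_add h1 hh, integral_add hf (hg.const_mul 2), integral_const_mul]
  simp only [integral_const, probReal_univ, one_smul]
  ring

/-- The remainder bound has finite mean, and this mean tends to zero: the terms that are quadratic
in the fluctuations have mean of order `√n / nⱼ`. -/
lemma remainderBound_integrable_tendsto (hK : Measurable (fun p : 𝒳 × 𝒳 => ker H p.1 p.2))
    {B : ℝ} (hB0 : 0 ≤ B) (hB : ∀ x : 𝒳, ‖feature H x‖ ≤ B) {s : ℕ} [NeZero s]
    {P : Fin s → Measure 𝒳} [∀ j, IsProbabilityMeasure (P j)] {X : Fin s → ℕ → Ω → 𝒳}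
    (hlaw : ∀ j i, HasLaw (X j i) (P j) μ)
    (hindep : iIndepFun (fun p : Fin s × ℕ => X p.1 p.2) μ)
    {n : ℕ → Fin s → ℕ} (hn : ∀ j, Tendsto (fun N => n N j) atTop atTop)
    {ρ : Fin s → ℝ} (hρ : ∀ j, 0 < ρ j)
    (hA2 : ∀ j, Tendsto (fun N => √(total (n N) : ℝ) * (fraction (n N) j - ρ j)) atTop (𝓝 0))
    {k : ℕ → ℕ → ℝ} {c τ : ℝ} {n₀ : ℕ} (hk : ∀ r, ∀ i ∈ Finset.Icc 1 r, |k r i| ≤ c)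
    (hA3 : ∀ r : ℕ, n₀ < r → (r : ℝ) * |1 / (r : ℝ) * ∑ i ∈ Finset.Icc 1 r, k r i - 1| ≤ τ) :
    (∀ N, Integrable (fun ω => remainderBound H P ρ B c (n N) k (fun j i => X j i ω)) μ) ∧
    Tendsto (fun N => ∫ ω, remainderBound H P ρ B c (n N) k (fun j i => X j i ω) ∂μ)
      atTop (𝓝 0) := by
  have hind : ∀ j, Pairwise fun i l => IndepFun (X j i) (X j l) μ := fun j i l hil =>
    hindep.indepFun (i := (j, i)) (j := (j, l)) (by simpa using hil)
  have h1 : ∀ r : ℕ, ∀ i ∈ Finset.Icc 1 r, |(fun _ => 1 : ℕ → ℝ) i| ≤ 1 := by simp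
  have hD : ∀ N j, Integrable (fun ω =>
      ‖centredMean H (P j) (n N j) (fun _ => 1) (fun i => X j i ω)‖ ^ 2) μ := fun N j =>
    (integral_norm_centredMean_sq_le hK hB0 hB (hlaw j) (hind j) (n N j) (h1 _)).1
  have hE : ∀ N j, Integrable (fun ω =>
      ‖centredMean H (P j) (n N j) (k (n N j)) (fun i => X j i ω)‖ ^ 2) μ := fun N j =>
    (integral_norm_centredMean_sq_le hK hB0 hB (hlaw j) (hind j) (n N j) (hk _)).1
  have hterm := fun N j l => integral_const_add_mul_add_const (hD N j) (hD N l) (hE N j)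
    (|√(total (n N) : ℝ) * (fraction (n N) l - ρ l)| * (16 * B ^ 2 + 2 * B * (c * (2 * B))))
    (√(total (n N) : ℝ)) (√(total (n N) : ℝ) *
      |1 / (n N j : ℝ) * ∑ i ∈ Finset.Icc 1 (n N j), k (n N j) i - 1| * (6 * B ^ 2))
  unfold remainderBound
  refine ⟨fun N => integrable_finsetSum _ fun j _ => integrable_finsetSum _ fun l _ =>
    (hterm N j l).1, ?_⟩
  have hswap := fun N => integral_finsetSum (μ := μ) Finset.univ
    fun j _ => integrable_finsetSum (Finset.univ.erase j) fun l _ => (hterm N j l).1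
  have hswap' := fun N j => integral_finsetSum (μ := μ) (Finset.univ.erase j)
    fun l _ => (hterm N j l).1
  simp_rw [hswap, hswap', fun N j l => (hterm N j l).2]
  rw [show (0 : ℝ) = ∑ j : Fin s, ∑ l ∈ Finset.univ.erase j, 0 by simp]
  refine tendsto_finsetSum _ fun j _ => tendsto_finsetSum _ fun l _ => ?_
  have hw : ∀ N, 0 ≤ √(total (n N) : ℝ) := fun N => Real.sqrt_nonneg _
  have hr := tendsto_sqrt_total_div hn hρ hA2
  have t1 := (hA2 l).abs.mul_const (16 * B ^ 2 + 2 * B * (c * (2 * B)))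
  have tD : ∀ j, _ := fun j => tendsto_sqrt_mul_integral_centredMean hK hB0 hB (hlaw j)
    (hind j) (a := fun _ _ => 1) h1 hw (hr j)
  have tE := tendsto_sqrt_mul_integral_centredMean hK hB0 hB (hlaw j) (hind j) hk hw (hr j)
  have t3 : Tendsto (fun N => √(total (n N) : ℝ) *
      |1 / (n N j : ℝ) * ∑ i ∈ Finset.Icc 1 (n N j), k (n N j) i - 1|) atTop (𝓝 0) := by
    have h := (hr j).mul_const τ
    rw [zero_mul] at h
    refine squeeze_zero' (Eventually.of_forall fun N => mul_nonneg (hw N) (abs_nonneg _)) ?_ h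
    filter_upwards [(hn j).eventually_gt_atTop n₀] with N hN
    have hpos : (0 : ℝ) < n N j := Nat.cast_pos.2 (by omega)
    have e : √(total (n N) : ℝ) / n N j * τ = √(total (n N) : ℝ) * (τ / n N j) := by ring
    rw [e]
    refine mul_le_mul_of_nonneg_left ?_ (hw N)
    rw [le_div_iff₀ hpos, mul_comm]
    exact hA3 _ hN
  have := (t1.add (((tD j).add ((tD l).const_mul 2)).add tE)).add (t3.mul_const (6 * B ^ 2))
  simpa using this

end Probability

section LimitLaw

variable {𝒳 : Type*} {H : Type*} [NormedAddCommGroup H] [InnerProductSpace ℝ H]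
  [CompleteSpace H] [RKHS ℝ H 𝒳 ℝ] [MeasurableSpace 𝒳]

/-! ### The limit variance -/

lemma integrable_inner_centredFeature_mul (hK : Measurable (fun p : 𝒳 × 𝒳 => ker H p.1 p.2))
    {B : ℝ} (hB0 : 0 ≤ B) (hB : ∀ x : 𝒳, ‖feature H x‖ ≤ B) (P : Measure 𝒳)
    [IsProbabilityMeasure P] (f g : H) :
    Integrable (fun x => inner ℝ (centredFeature H P x) f * inner ℝ (centredFeature H P x) g) P := by
  refine Integrable.of_bound ((measurable_inner_centredFeature hK P f).mul
    (measurable_inner_centredFeature hK P g)).aestronglyMeasurable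
    ((2 * B * ‖f‖) * (2 * B * ‖g‖)) (ae_of_all _ fun x => ?_)
  rw [norm_mul]
  exact mul_le_mul (abs_inner_centredFeature_le hK hB0 hB P x f)
    (abs_inner_centredFeature_le hK hB0 hB P x g) (norm_nonneg _) (by positivity)

/-- Both `𝒰ⱼ` and `𝒱ⱼ` are centred, so the second moment of `𝒰ⱼ - a 𝒱ⱼ` is its variance. -/
lemma integral_sub_mul_sq (hK : Measurable (fun p : 𝒳 × 𝒳 => ker H p.1 p.2))
    {B : ℝ} (hB0 : 0 ≤ B) (hB : ∀ x : 𝒳, ‖feature H x‖ ≤ B) {s : ℕ} (P : Fin s → Measure 𝒳)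
    [∀ j, IsProbabilityMeasure (P j)] (ρ : Fin s → ℝ) (j : Fin s) (a : ℝ) :
    ∫ x, (U H P ρ j x - a * V H P ρ j x) ^ 2 ∂(P j)
      = Var[U H P ρ j; P j] + a ^ 2 * Var[V H P ρ j; P j]
        - 2 * a * cov[U H P ρ j, V H P ρ j; P j] := by
  have hU : U H P ρ j = fun x => inner ℝ (centredFeature H (P j) x) (uVec H P ρ j) := rfl
  have hV : V H P ρ j = fun x => inner ℝ (centredFeature H (P j) x) (vVec H P ρ j) := rfl
  have iU := integrable_inner_centredFeature_mul hK hB0 hB (P j) (uVec H P ρ j) (uVec H P ρ j)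
  have iV := integrable_inner_centredFeature_mul hK hB0 hB (P j) (vVec H P ρ j) (vVec H P ρ j)
  have iUV := integrable_inner_centredFeature_mul hK hB0 hB (P j) (uVec H P ρ j) (vVec H P ρ j)
  have mU := (measurable_inner_centredFeature hK (P j) (uVec H P ρ j)).aemeasurable (μ := P j)
  have mV := (measurable_inner_centredFeature hK (P j) (vVec H P ρ j)).aemeasurable (μ := P j)
  have zU := integral_inner_centredFeature hK hB (P j) (uVec H P ρ j)
  have zV := integral_inner_centredFeature hK hB (P j) (vVec H P ρ j)
  rw [hU, hV, variance_of_integral_eq_zero mU zU, variance_of_integral_eq_zero mV zV, covariance,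
    zU, zV]
  simp only [sub_zero]
  have hexp : ∀ x, (inner ℝ (centredFeature H (P j) x) (uVec H P ρ j)
        - a * inner ℝ (centredFeature H (P j) x) (vVec H P ρ j)) ^ 2
      = inner ℝ (centredFeature H (P j) x) (uVec H P ρ j)
          * inner ℝ (centredFeature H (P j) x) (uVec H P ρ j)
        + a ^ 2 * (inner ℝ (centredFeature H (P j) x) (vVec H P ρ j)
          * inner ℝ (centredFeature H (P j) x) (vVec H P ρ j))
        - 2 * a * (inner ℝ (centredFeature H (P j) x) (uVec H P ρ j)
          * inner ℝ (centredFeature H (P j) x) (vVec H P ρ j)) := fun x => by ring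
  simp_rw [hexp]
  have iS := iU.add (iV.const_mul (a ^ 2))
  simp only [Pi.add_def] at iS
  rw [integral_sub iS (iUV.const_mul _), integral_add iU (iV.const_mul _), integral_const_mul,
    integral_const_mul]
  simp only [sq]

lemma sigmaSqPart_nonneg (hK : Measurable (fun p : 𝒳 × 𝒳 => ker H p.1 p.2))
    {B : ℝ} (hB0 : 0 ≤ B) (hB : ∀ x : 𝒳, ‖feature H x‖ ≤ B) {s : ℕ} (P : Fin s → Measure 𝒳)
    [∀ j, IsProbabilityMeasure (P j)] (ρ : Fin s → ℝ) {q : ℝ} (hq : 1 < q) (j : Fin s) :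
    0 ≤ sigmaSqPart H P ρ q j := by
  -- `q > 1`, so `σⱼ²` is at least the variance of `𝒰ⱼ - 𝒱ⱼ`
  have h := integral_sub_mul_sq hK hB0 hB P ρ j 1
  have h0 : 0 ≤ ∫ x, (U H P ρ j x - 1 * V H P ρ j x) ^ 2 ∂(P j) :=
    integral_nonneg fun x => sq_nonneg _
  have hV := variance_nonneg (V H P ρ j) (P j)
  rw [sigmaSqPart]
  nlinarith

lemma sigmaSq_nonneg (hK : Measurable (fun p : 𝒳 × 𝒳 => ker H p.1 p.2))
    {B : ℝ} (hB0 : 0 ≤ B) (hB : ∀ x : 𝒳, ‖feature H x‖ ≤ B) {s : ℕ} (P : Fin s → Measure 𝒳)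
    [∀ j, IsProbabilityMeasure (P j)] {ρ : Fin s → ℝ} (hρ : ∀ j, 0 < ρ j) {q : ℝ} (hq : 1 < q) :
    0 ≤ sigmaSq H P ρ q :=
  Finset.sum_nonneg fun j _ => mul_nonneg (mul_nonneg (by norm_num) (inv_nonneg.2 (hρ j).le))
    (sigmaSqPart_nonneg hK hB0 hB P ρ hq j)

/-- The limit variance when all distributions agree; then `𝒰ⱼ` and `𝒱ⱼ` are the same function. -/
lemma sigmaSq_const (hK : Measurable (fun p : 𝒳 × 𝒳 => ker H p.1 p.2)) {s : ℕ}
    (Q : Measure 𝒳) (ρ : Fin s → ℝ) (hρ : ∑ j, ρ j = 1) (q : ℝ) :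
    sigmaSq H (fun _ => Q) ρ q
      = 4 * (q - 1) * nuSq H Q * ∑ j, (ρ j)⁻¹ * (1 - ρ j) ^ 2 := by
  have hu : ∀ j, uVec H (fun _ => Q) ρ j = (1 - ρ j) • meanEmbedding H Q := by
    intro j
    rw [uVec, sumMean, Finset.sum_const, Finset.card_univ, Fintype.card_fin,
      ← Nat.cast_smul_eq_nsmul ℝ]
    module
  have hv : ∀ j, vVec H (fun _ => Q) ρ j = (1 - ρ j) • meanEmbedding H Q := by
    intro j
    rw [vVec, mixMean, ← Finset.sum_smul, hρ]
    module
  have hU : ∀ j, U H (fun _ => Q) ρ j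
      = fun x => (1 - ρ j) * inner ℝ (feature H x - meanEmbedding H Q) (meanEmbedding H Q) := by
    intro j
    ext x
    rw [← real_inner_smul_right, ← hu j]
    rfl
  have hV : ∀ j, V H (fun _ => Q) ρ j
      = fun x => (1 - ρ j) * inner ℝ (feature H x - meanEmbedding H Q) (meanEmbedding H Q) := by
    intro j
    ext x
    rw [← real_inner_smul_right, ← hv j]
    rfl
  have hm : AEMeasurable
      (fun x => inner ℝ (feature H x - meanEmbedding H Q) (meanEmbedding H Q)) Q :=
    (measurable_inner_centredFeature hK Q (meanEmbedding H Q)).aemeasurable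
  rw [sigmaSq, Finset.mul_sum]
  refine Finset.sum_congr rfl fun j _ => ?_
  rw [sigmaSqPart, hU, hV, covariance_self (hm.const_mul _), variance_const_mul, nuSq]
  ring

variable {Ω : Type*} [MeasurableSpace Ω] {μ : Measure Ω}

/-! ### Measurability of the estimator -/

lemma aemeasurable_inner_feature_empMean (hK : Measurable (fun p : 𝒳 × 𝒳 => ker H p.1 p.2))
    {Y : Ω → 𝒳} (hY : AEMeasurable Y μ) {Y' : ℕ → Ω → 𝒳} (hY' : ∀ i, AEMeasurable (Y' i) μ)
    (r : ℕ) :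
    AEMeasurable (fun ω => inner ℝ (feature H (Y ω)) (empMean H r fun i => Y' i ω)) μ := by
  simp_rw [empMean, real_inner_smul_right, inner_sum, inner_feature_feature]
  exact (Finset.aemeasurable_fun_sum _ fun i _ =>
    hK.comp_aemeasurable (hY.prodMk (hY' i))).const_mul _

lemma aemeasurable_norm_empMean_sq (hK : Measurable (fun p : 𝒳 × 𝒳 => ker H p.1 p.2))
    {Y : ℕ → Ω → 𝒳} (hY : ∀ i, AEMeasurable (Y i) μ) (r : ℕ) :
    AEMeasurable (fun ω => ‖empMean H r fun i => Y i ω‖ ^ 2) μ := by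
  have h : ∀ ω, ‖empMean H r fun i => Y i ω‖ ^ 2 = (r : ℝ)⁻¹ * ∑ i ∈ Finset.Icc 1 r,
      inner ℝ (feature H (Y i ω)) (empMean H r fun i => Y i ω) := by
    intro ω
    rw [← real_inner_self_eq_norm_sq, ← sum_inner, ← real_inner_smul_left]
    rfl
  simp_rw [h]
  exact (Finset.aemeasurable_fun_sum _ fun i _ =>
    aemeasurable_inner_feature_empMean hK (hY i) hY r).const_mul _

lemma aemeasurable_estimator (hK : Measurable (fun p : 𝒳 × 𝒳 => ker H p.1 p.2)) {s : ℕ}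
    {X : Fin s → ℕ → Ω → 𝒳} (hX : ∀ j i, AEMeasurable (X j i) μ) (n : Fin s → ℕ)
    (k : ℕ → ℕ → ℝ) : AEMeasurable (fun ω => estimator H n k fun j i => X j i ω) μ := by
  unfold estimator
  refine Finset.aemeasurable_fun_sum _ fun j _ => Finset.aemeasurable_fun_sum _ fun l _ => ?_
  refine AEMeasurable.const_mul (((aemeasurable_norm_empMean_sq hK (hX j) _).add
    (aemeasurable_norm_empMean_sq hK (hX l) _)).sub (AEMeasurable.const_mul ?_ _)) _
  exact Finset.aemeasurable_fun_sum _ fun i _ =>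
    (aemeasurable_inner_feature_empMean hK (hX j i) (hX l) _).const_mul _

/-! ### The limit law of the linearization -/

variable [IsProbabilityMeasure μ]

lemma measurable_linearTerm (hK : Measurable (fun p : 𝒳 × 𝒳 => ker H p.1 p.2)) {s : ℕ}
    (P : Fin s → Measure 𝒳) (ρ : Fin s → ℝ) (n : Fin s → ℕ) (k : ℕ → ℕ → ℝ)
    (p : Σ _ : Fin s, ℕ) : Measurable (linearTerm H P ρ n k p) :=
  ((measurable_inner_centredFeature hK (P p.1) (uVec H P ρ p.1)).sub
    ((measurable_inner_centredFeature hK (P p.1) (vVec H P ρ p.1)).const_mul _)).const_mul _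

/-- A bound that is uniform over the row. The sum over `j` only serves to dominate the term
of the sample `p.1`. -/
lemma abs_linearTerm_le (hK : Measurable (fun p : 𝒳 × 𝒳 => ker H p.1 p.2))
    {B : ℝ} (hB0 : 0 ≤ B) (hB : ∀ x : 𝒳, ‖feature H x‖ ≤ B) {s : ℕ} (P : Fin s → Measure 𝒳)
    [∀ j, IsProbabilityMeasure (P j)] (ρ : Fin s → ℝ) (n : Fin s → ℕ) {k : ℕ → ℕ → ℝ} {c : ℝ}
    (hc : 0 ≤ c) (p : Σ _ : Fin s, ℕ) (hk : |k (n p.1) p.2| ≤ c) (x : 𝒳) :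
    |linearTerm H P ρ n k p x| ≤ ∑ j, √(total n : ℝ) / n j *
      (2 * (2 * B * ‖uVec H P ρ j‖ + c * (2 * B * ‖vVec H P ρ j‖))) := by
  refine le_trans ?_ (Finset.single_le_sum (f := fun j => √(total n : ℝ) / n j *
      (2 * (2 * B * ‖uVec H P ρ j‖ + c * (2 * B * ‖vVec H P ρ j‖))))
      (fun j _ => by positivity) (Finset.mem_univ p.1))
  have h1 : |U H P ρ p.1 x - k (n p.1) p.2 * V H P ρ p.1 x|
      ≤ 2 * B * ‖uVec H P ρ p.1‖ + c * (2 * B * ‖vVec H P ρ p.1‖) := by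
    refine (abs_sub _ _).trans (add_le_add ?_ ?_)
    · exact abs_inner_centredFeature_le hK hB0 hB (P p.1) x (uVec H P ρ p.1)
    · rw [abs_mul]
      exact mul_le_mul hk (abs_inner_centredFeature_le hK hB0 hB (P p.1) x (vVec H P ρ p.1))
        (abs_nonneg _) hc
  have h2 : 0 ≤ √(total n : ℝ) / n p.1 := by positivity
  rw [linearTerm, abs_mul, abs_mul, abs_two, abs_of_nonneg h2]
  calc _ ≤ 2 * (√(total n : ℝ) / n p.1) *
        (2 * B * ‖uVec H P ρ p.1‖ + c * (2 * B * ‖vVec H P ρ p.1‖)) := by gcongr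
    _ = _ := by ring

lemma integral_linearTerm (hK : Measurable (fun p : 𝒳 × 𝒳 => ker H p.1 p.2))
    {B : ℝ} (hB0 : 0 ≤ B) (hB : ∀ x : 𝒳, ‖feature H x‖ ≤ B) {s : ℕ} (P : Fin s → Measure 𝒳)
    [∀ j, IsProbabilityMeasure (P j)] (ρ : Fin s → ℝ) (n : Fin s → ℕ) (k : ℕ → ℕ → ℝ)
    (p : Σ _ : Fin s, ℕ) : ∫ x, linearTerm H P ρ n k p x ∂(P p.1) = 0 := by
  have hi : ∀ f : H, Integrable (fun x => inner ℝ (centredFeature H (P p.1) x) f) (P p.1) :=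
    fun f => Integrable.of_bound
      (measurable_inner_centredFeature hK (P p.1) f).aestronglyMeasurable (2 * B * ‖f‖)
      (ae_of_all _ fun x => abs_inner_centredFeature_le hK hB0 hB (P p.1) x f)
  have hU : ∫ x, U H P ρ p.1 x ∂(P p.1) = 0 :=
    integral_inner_centredFeature hK hB (P p.1) (uVec H P ρ p.1)
  have hV : ∫ x, V H P ρ p.1 x ∂(P p.1) = 0 :=
    integral_inner_centredFeature hK hB (P p.1) (vVec H P ρ p.1)
  have iU : Integrable (U H P ρ p.1) (P p.1) := hi (uVec H P ρ p.1)
  have iV : Integrable (V H P ρ p.1) (P p.1) := hi (vVec H P ρ p.1)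
  unfold linearTerm
  rw [integral_const_mul, integral_sub iU (iV.const_mul _), integral_const_mul, hU, hV]
  simp

/-- The total variance of the linearization. -/
lemma sum_integral_linearTerm_sq (hK : Measurable (fun p : 𝒳 × 𝒳 => ker H p.1 p.2))
    {B : ℝ} (hB0 : 0 ≤ B) (hB : ∀ x : 𝒳, ‖feature H x‖ ≤ B) {s : ℕ} (P : Fin s → Measure 𝒳)
    [∀ j, IsProbabilityMeasure (P j)] (ρ : Fin s → ℝ) (n : Fin s → ℕ) (k : ℕ → ℕ → ℝ)
    (hn : ∀ j, n j ≠ 0) :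
    ∑ p ∈ Finset.univ.sigma fun j => Finset.Icc 1 (n j),
        ∫ x, linearTerm H P ρ n k p x ^ 2 ∂(P p.1)
      = ∑ j, 4 * ((total n : ℝ) / n j) * (Var[U H P ρ j; P j]
        + (1 / (n j : ℝ) * ∑ i ∈ Finset.Icc 1 (n j), k (n j) i ^ 2) * Var[V H P ρ j; P j]
        - 2 * ((1 / (n j : ℝ) * ∑ i ∈ Finset.Icc 1 (n j), k (n j) i)
          * cov[U H P ρ j, V H P ρ j; P j])) := by
  rw [Finset.sum_sigma]
  refine Finset.sum_congr rfl fun j _ => ?_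
  have hnj : (n j : ℝ) ≠ 0 := Nat.cast_ne_zero.2 (hn j)
  simp_rw [linearTerm, mul_pow, integral_const_mul, integral_sub_mul_sq hK hB0 hB]
  rw [← Finset.mul_sum, Finset.sum_sub_distrib, Finset.sum_add_distrib, ← Finset.sum_mul,
    ← Finset.sum_mul, ← Finset.mul_sum, Finset.sum_const, Nat.card_Icc, Nat.add_sub_cancel,
    nsmul_eq_mul, div_pow, Real.sq_sqrt (Nat.cast_nonneg _)]
  field_simp
  ring

/-- The sum of the linear terms is asymptotically normal: given the sample sizes, the terms of all
samples together form one row of a triangular array. -/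
lemma tendstoInDistribution_sum_linearTerm
    (hK : Measurable (fun p : 𝒳 × 𝒳 => ker H p.1 p.2))
    {B : ℝ} (hB0 : 0 ≤ B) (hB : ∀ x : 𝒳, ‖feature H x‖ ≤ B) {s : ℕ} [NeZero s]
    {P : Fin s → Measure 𝒳} [∀ j, IsProbabilityMeasure (P j)] {X : Fin s → ℕ → Ω → 𝒳}
    (hlaw : ∀ j i, HasLaw (X j i) (P j) μ)
    (hindep : iIndepFun (fun p : Fin s × ℕ => X p.1 p.2) μ)
    {n : ℕ → Fin s → ℕ} (hn : ∀ j, Tendsto (fun N => n N j) atTop atTop)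
    {ρ : Fin s → ℝ} (hρ : ∀ j, 0 < ρ j)
    (hA2 : ∀ j, Tendsto (fun N => √(total (n N) : ℝ) * (fraction (n N) j - ρ j)) atTop (𝓝 0))
    {k : ℕ → ℕ → ℝ} {c q : ℝ} (hc : 0 ≤ c) (hk : ∀ r, ∀ i ∈ Finset.Icc 1 r, |k r i| ≤ c)
    (hmean : Tendsto (fun r : ℕ => 1 / (r : ℝ) * ∑ i ∈ Finset.Icc 1 r, k r i) atTop (𝓝 1))
    (hsq : Tendsto (fun r : ℕ => 1 / (r : ℝ) * ∑ i ∈ Finset.Icc 1 r, k r i ^ 2) atTop (𝓝 q))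
    (hq : 1 < q) :
    TendstoInDistribution
      (fun N ω => ∑ p ∈ Finset.univ.sigma fun j => Finset.Icc 1 (n N j),
        linearTerm H P ρ (n N) k p (X p.1 p.2 ω))
      atTop id (fun _ => μ) (gaussianReal 0 (sigmaSq H P ρ q).toNNReal) := by
  have hm : ∀ N p, Measurable (linearTerm H P ρ (n N) k p) := fun N p =>
    measurable_linearTerm hK P ρ (n N) k p
  have hindep' : iIndepFun (fun p : Σ _ : Fin s, ℕ => X p.1 p.2) μ :=
    hindep.precomp (g := fun p : Σ _ : Fin s, ℕ => (p.1, p.2)) (by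
      rintro ⟨j, i⟩ ⟨j', i'⟩ h
      simpa using h)
  refine tendstoInDistribution_sum_of_bounded
    (fun N (p : Σ _ : Fin s, ℕ) ω => linearTerm H P ρ (n N) k p (X p.1 p.2 ω)) _
    (fun N p => (hm N p).comp_aemeasurable (hlaw p.1 p.2).aemeasurable)
    (fun N => hindep'.comp (fun p => linearTerm H P ρ (n N) k p) (hm N))
    (fun N => ∑ j, √(total (n N) : ℝ) / n N j *
      (2 * (2 * B * ‖uVec H P ρ j‖ + c * (2 * B * ‖vVec H P ρ j‖)))) ?_ ?_ ?_
    (sigmaSq_nonneg hK hB0 hB P hρ hq) ?_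
  · rw [show (0 : ℝ) = ∑ j : Fin s, 0 *
      (2 * (2 * B * ‖uVec H P ρ j‖ + c * (2 * B * ‖vVec H P ρ j‖))) by simp]
    exact tendsto_finsetSum _ fun j _ => (tendsto_sqrt_total_div hn hρ hA2 j).mul_const _
  · intro N p hp
    refine ae_of_all _ fun ω => abs_linearTerm_le hK hB0 hB P ρ (n N) hc p ?_ _
    exact hk _ _ (Finset.mem_sigma.1 hp).2
  · intro N p
    exact ((hlaw p.1 p.2).integral_comp (hm N p).aestronglyMeasurable).trans
      (integral_linearTerm hK hB0 hB P ρ (n N) k p)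
  · have hlim : Tendsto (fun N => ∑ j, 4 * ((total (n N) : ℝ) / n N j) * (Var[U H P ρ j; P j]
        + (1 / (n N j : ℝ) * ∑ i ∈ Finset.Icc 1 (n N j), k (n N j) i ^ 2) * Var[V H P ρ j; P j]
        - 2 * ((1 / (n N j : ℝ) * ∑ i ∈ Finset.Icc 1 (n N j), k (n N j) i)
          * cov[U H P ρ j, V H P ρ j; P j]))) atTop (𝓝 (sigmaSq H P ρ q)) := by
      refine tendsto_finsetSum _ fun j _ => ?_
      have h1 := (hmean.comp (hn j)).mul_const (cov[U H P ρ j, V H P ρ j; P j])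
      rw [one_mul] at h1
      exact ((tendsto_total_div hn hρ hA2 j).const_mul 4).mul
        ((((hsq.comp (hn j)).mul_const _).const_add _).sub (h1.const_mul 2))
    refine hlim.congr' ?_
    filter_upwards [eventually_all.2 fun j => (hn j).eventually_ne_atTop 0] with N hN
    rw [← sum_integral_linearTerm_sq hK hB0 hB P ρ (n N) k hN]
    refine Finset.sum_congr rfl fun p _ => ?_
    exact ((hlaw p.1 p.2).integral_comp
      (f := fun x => linearTerm H P ρ (n N) k p x ^ 2)
      ((hm N p).pow_const 2).aestronglyMeasurable).symm

end LimitLaw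

end GMMD

theorem theorem1
    {𝒳 : Type*} [MetricSpace 𝒳] [MeasurableSpace 𝒳] [BorelSpace 𝒳]
    (H : Type*) [NormedAddCommGroup H] [InnerProductSpace ℝ H] [CompleteSpace H] [RKHS ℝ H 𝒳 ℝ]
    (hK : Measurable (fun p : 𝒳 × 𝒳 => GMMD.ker H p.1 p.2))
    -- the kernel is bounded
    (hA1 : BddAbove (Set.range (fun p : 𝒳 × 𝒳 => GMMD.ker H p.1 p.2)))
    {s : ℕ} (hs : 2 ≤ s)
    -- the distributions, and independent i.i.d. samples drawn from them
    (P : Fin s → Measure 𝒳)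
    {Ω : Type*} [MeasurableSpace Ω] (μ : Measure Ω) [IsProbabilityMeasure μ]
    (X : Fin s → ℕ → Ω → 𝒳)
    (hlaw : ∀ j i, HasLaw (X j i) (P j) μ)
    (hindep : iIndepFun (fun p : Fin s × ℕ => X p.1 p.2) μ)
    -- the sample sizes, all tending to infinity, and the sample fractions
    (n : ℕ → Fin s → ℕ) (hn : ∀ j, Tendsto (fun N => n N j) atTop atTop)
    (ρ : Fin s → ℝ) (hρ : ∀ j, ρ j ∈ Set.Ioo (0 : ℝ) 1)
    (hA2 : ∀ j, Tendsto
      (fun N => √(GMMD.total (n N) : ℝ) * (GMMD.fraction (n N) j - ρ j)) atTop (𝓝 0))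
    -- the weights `k γ r i`, for `1 ≤ i ≤ r`, and the limit `kSq γ` of their mean squares
    (k : ℝ → ℕ → ℕ → ℝ) (kSq : ℝ → ℝ)
    (hk : ∀ γ ∈ Set.Ioc (0 : ℝ) 1, ∀ r, ∀ i ∈ Finset.Icc 1 r, 0 ≤ k γ r i)
    (hA3 : ∀ γ ∈ Set.Ioc (0 : ℝ) 1, ∃ τ : ℝ, 0 < τ ∧ ∃ n₀ : ℕ, ∀ r : ℕ, n₀ < r →
      (r : ℝ) * |1 / (r : ℝ) * ∑ i ∈ Finset.Icc 1 r, k γ r i - 1| ≤ τ)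
    (hA4 : ∃ c : ℝ, ∀ γ ∈ Set.Ioc (0 : ℝ) 1, ∀ r, ∀ i ∈ Finset.Icc 1 r, k γ r i < c)
    (hA5 : ∀ γ ∈ Set.Ioc (0 : ℝ) 1,
      Tendsto (fun r : ℕ => 1 / (r : ℝ) * ∑ i ∈ Finset.Icc 1 r, k γ r i ^ 2) atTop (𝓝 (kSq γ))
        ∧ 1 < kSq γ)
    (γ : ℝ) (hγ : γ ∈ Set.Ioc (0 : ℝ) 1) :
    -- the mean embeddings exist
    (∀ j, GMMD.IsMeanEmbedding H (P j) (GMMD.meanEmbedding H (P j))) ∧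
    0 ≤ GMMD.sigmaSq H P ρ (kSq γ) ∧
    TendstoInDistribution
      (fun N ω => √(GMMD.total (n N) : ℝ) *
        (GMMD.estimator H (n N) (k γ) (fun j i => X j i ω) - GMMD.gmmdSq H P ρ))
      atTop id (fun _ => μ) (gaussianReal 0 (GMMD.sigmaSq H P ρ (kSq γ)).toNNReal) ∧
    -- the limit variance when all distributions are equal
    ((∀ j l, P j = P l) → ∀ j₀,
      GMMD.sigmaSq H P ρ (kSq γ)
          = 4 * (kSq γ - 1) * GMMD.nuSq H (P j₀) * ∑ j, (ρ j)⁻¹ * (1 - ρ j) ^ 2 ∧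
      (0 < GMMD.sigmaSq H P ρ (kSq γ) ↔ 0 < GMMD.nuSq H (P j₀))) := by
  have : NeZero s := ⟨by omega⟩
  have hP : ∀ j, IsProbabilityMeasure (P j) := fun j =>
    (hlaw j 0).isProbabilityMeasure_iff.1 inferInstance
  obtain ⟨B, hB0, hB⟩ := GMMD.exists_norm_feature_le hA1
  obtain ⟨c, hc⟩ := hA4
  obtain ⟨τ, -, n₀, hτ⟩ := hA3 γ hγ
  obtain ⟨hsq, hq⟩ := hA5 γ hγ
  have hρ0 : ∀ j, 0 < ρ j := fun j => (hρ j).1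
  have hc0 : 0 ≤ c := (hk γ hγ 1 1 (by simp)).trans (hc γ hγ 1 1 (by simp)).le
  have hkc : ∀ r, ∀ i ∈ Finset.Icc 1 r, |k γ r i| ≤ c := fun r i hi => by
    rw [abs_of_nonneg (hk γ hγ r i hi)]
    exact (hc γ hγ r i hi).le
  have hsum : ∑ j, ρ j = 1 := GMMD.sum_eq_one hn hA2
  refine ⟨fun j => GMMD.isMeanEmbedding_meanEmbedding hK hB (P j),
    GMMD.sigmaSq_nonneg hK hB0 hB P hρ0 hq, ?_, ?_⟩
  · have hL := GMMD.tendstoInDistribution_sum_linearTerm hK hB0 hB hlaw hindep hn hρ0 hA2 hc0 hkc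
      (GMMD.tendsto_mean_weight hτ) hsq hq
    have hT : ∀ N, AEMeasurable (fun ω => √(GMMD.total (n N) : ℝ) *
        (GMMD.estimator H (n N) (k γ) (fun j i => X j i ω) - GMMD.gmmdSq H P ρ)) μ := fun N =>
      ((GMMD.aemeasurable_estimator hK (fun j i => (hlaw j i).aemeasurable) (n N) (k γ)).sub_const
        _).const_mul _
    have hG := GMMD.remainderBound_integrable_tendsto hK hB0 hB hlaw hindep hn hρ0 hA2 hkc hτ
    refine tendstoInDistribution_of_tendstoInMeasure_sub _ _ hL
      (GMMD.tendstoInMeasure_zero_of_abs_le (fun N => (hT N).sub (hL.forall_aemeasurable N))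
        hG.1 ?_ hG.2) hT
    -- an empty sample has empirical mean `0`, so the linearization needs positive sample sizes
    filter_upwards [eventually_all.2 fun j => (hn j).eventually_ne_atTop 0] with N hN ω
    exact GMMD.abs_estimator_sub_sum_linearTerm_le hK hB0 hB P ρ hsum (n N) hN (k γ) hc0 hkc
      fun j i => X j i ω
  · intro hPP j₀
    have hconst : P = fun _ => P j₀ := funext fun j => hPP j j₀
    have hσ : GMMD.sigmaSq H P ρ (kSq γ)
        = 4 * (kSq γ - 1) * GMMD.nuSq H (P j₀) * ∑ j, (ρ j)⁻¹ * (1 - ρ j) ^ 2 := by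
      conv_lhs => rw [hconst]
      exact GMMD.sigmaSq_const hK (P j₀) ρ hsum (kSq γ)
    refine ⟨hσ, ?_⟩
    have hS : 0 < ∑ j, (ρ j)⁻¹ * (1 - ρ j) ^ 2 :=
      Finset.sum_pos (fun j _ => mul_pos (inv_pos.2 (hρ j).1) (pow_pos (sub_pos.2 (hρ j).2) 2))
        Finset.univ_nonempty
    rw [hσ, mul_pos_iff_of_pos_right hS, mul_pos_iff_of_pos_left (by linarith)]
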